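/- Let $k$ be a field. By a variety in a projective space we mean a reduced and irreducible closed subscheme. A (not necessarily normal) toric variety is a variety $W\subset\mathbb P^q$ with an action of a torus $\mathbb G_m^r$ that has an open dense orbit (of a rational point) and an open covering by invariant affine open subsets. Let $\mathfrak X\subset\mathbb P^q\times\mathbb A^1$ be a toric degeneration of a variety $X\subset\mathbb P^q$ of positive dimension to $W\subset\mathbb P^q$; that is, $\mathfrak X$ is a closed subscheme that is flat and surjective over $\mathbb A^1$ and isomorphic to $X\times(\mathbb A^1-0)$ over $\mathbb A^1-0$, its fibre over $1$ is $X$, and its fibre over $0$ is $W$, a toric variety. Let $m\ge 1$, let $v:\mathbb P^q\hookrightarrow\mathbb P^N$, $N=\binom{q+m}{m}-1$, be the $m$-th Veronese embedding (given by all monomials of degree $m$), and let $z_0,\dots,z_q,w_1,\dots,w_{N-q}$ be homogeneous coordinates on $\mathbb P^N$ (a basis of the space of linear forms; for instance, the standard coordinates in some order). Let $p:\mathbb P^N-V(z_0,\dots,z_q)\to\mathbb P^q$ be the linear projection given by $z_0,\dots,z_q$, and identify $\mathbb P^q$ also with the subspace $V(w_1,\dots,w_{N-q})\subset\mathbb P^N$.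 Assume that $p\circ v$ restricts to a dominant morphism $\varphi:X-B\to W$, where $B=X\cap v^{-1}(V(z_0,\dots,z_q))$. Let $\mathbb G_m$ act on $\mathbb P^N$ by $t\cdot[z:w]=[z:tw]$, and let $$\mathfrak X'=\overline{\{(t\cdot x,t)\mid t\in\mathbb G_m,\ x\in v(X)\}}\subset\mathbb P^N\times\mathbb A^1$$ (scheme-theoretic closure) be the degeneration of $v(X)$ by the projection $p$, with fibre $X'\subset\mathbb P^N$ over $0$. Then: 1. $X'$ is a variety if and only if $v$ is the identity, i.e. $m=1$. 2. In particular, unless $\mathfrak X$ is trivial, i.e. isomorphic to $X\times\mathbb A^1$ over $\mathbb A^1$, it is not given as such a degeneration by projection: $\mathfrak X$ is not isomorphic to $\mathfrak X'$ over $\mathbb A^1$. 3. $X'\cap\mathbb P^q=W$ as closed subschemes of $\mathbb P^q$. -/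

import Mathlib

open CategoryTheory AlgebraicGeometry
open scoped Polynomial LaurentPolynomial

universe u

noncomputable section

attribute [local instance] MvPolynomial.gradedAlgebra

/-! ## Quotients of graded algebras -/

/-- The `n`-th graded piece of `S / I`: the image of the `n`-th graded piece of `S`. -/
def quotientGrading {R S : Type*} [CommRing R] [CommRing S] [Algebra R S]
    (𝒜 : ℕ → Submodule R S) [GradedAlgebra 𝒜] (I : HomogeneousIdeal 𝒜) (n : ℕ) :
    Submodule R (S ⧸ I.toIdeal) :=
  (𝒜 n).map (Ideal.Quotient.mkₐ R I.toIdeal).toLinearMap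

instance quotientGrading_gradedMonoid {R S : Type*} [CommRing R] [CommRing S] [Algebra R S]
    (𝒜 : ℕ → Submodule R S) [GradedAlgebra 𝒜] (I : HomogeneousIdeal 𝒜) :
    SetLike.GradedMonoid (quotientGrading 𝒜 I) where
  one_mem := ⟨1, SetLike.GradedOne.one_mem, rfl⟩
  mul_mem := by
    rintro i j _ _ ⟨a, ha, rfl⟩ ⟨b, hb, rfl⟩
    exact ⟨a * b, SetLike.GradedMul.mul_mem ha hb, rfl⟩

/-- The projection `𝒜 n → (S / I)_n`. -/
def quotientGradingProj {R S : Type*} [CommRing R] [CommRing S] [Algebra R S]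
    (𝒜 : ℕ → Submodule R S) [GradedAlgebra 𝒜] (I : HomogeneousIdeal 𝒜) (n : ℕ) :
    𝒜 n →ₗ[R] quotientGrading 𝒜 I n :=
  (Ideal.Quotient.mkₐ R I.toIdeal).toLinearMap.restrict fun x hx => ⟨x, hx, rfl⟩

/-- The graded algebra homomorphism `S → ⨁ (S / I)_n`. -/
def quotientGradingAux {R S : Type*} [CommRing R] [CommRing S] [Algebra R S]
    (𝒜 : ℕ → Submodule R S) [GradedAlgebra 𝒜] (I : HomogeneousIdeal 𝒜) :
    S →ₐ[R] DirectSum ℕ fun n => quotientGrading 𝒜 I n :=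
  (DirectSum.toAlgebra R (fun n => 𝒜 n)
    (fun n => (DirectSum.lof R ℕ (fun n => quotientGrading 𝒜 I n) n).comp
      (quotientGradingProj 𝒜 I n))
    rfl
    (by
      intro i j a b
      simp only [LinearMap.comp_apply, DirectSum.lof_eq_of, DirectSum.of_mul_of]
      rfl)).comp (DirectSum.decomposeAlgEquiv 𝒜).toAlgHom

theorem quotientGradingAux_of_mem {R S : Type*} [CommRing R] [CommRing S] [Algebra R S]
    (𝒜 : ℕ → Submodule R S) [GradedAlgebra 𝒜] (I : HomogeneousIdeal 𝒜) {n : ℕ} (x : 𝒜 n) :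
    quotientGradingAux 𝒜 I x =
      DirectSum.of (fun n => quotientGrading 𝒜 I n) n (quotientGradingProj 𝒜 I n x) := by
  have h : DirectSum.decomposeAlgEquiv 𝒜 (x : S) = DirectSum.of (fun n => 𝒜 n) n x :=
    DirectSum.decompose_coe 𝒜 x
  simp only [quotientGradingAux, AlgHom.comp_apply, AlgEquiv.coe_toAlgHom, h]
  exact DirectSum.toAddMonoid_of (fun n => ((DirectSum.lof R ℕ
    (fun n => quotientGrading 𝒜 I n) n).comp (quotientGradingProj 𝒜 I n)).toAddMonoidHom) n x

theorem quotientGradingAux_eq_zero {R S : Type*} [CommRing R] [CommRing S] [Algebra R S]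
    (𝒜 : ℕ → Submodule R S) [GradedAlgebra 𝒜] (I : HomogeneousIdeal 𝒜) (x : S)
    (hx : x ∈ I.toIdeal) : quotientGradingAux 𝒜 I x = 0 := by
  classical
  rw [← DirectSum.sum_support_decompose 𝒜 x, map_sum]
  refine Finset.sum_eq_zero fun n _ => ?_
  rw [quotientGradingAux_of_mem]
  have : quotientGradingProj 𝒜 I n (DirectSum.decompose 𝒜 x n) = 0 :=
    Subtype.ext (Ideal.Quotient.eq_zero_iff_mem.mpr (I.isHomogeneous n hx))
  rw [this, map_zero]

/-- The quotient of a graded algebra by a homogeneous ideal is graded. -/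
instance quotientGrading_gradedAlgebra {R S : Type*} [CommRing R] [CommRing S] [Algebra R S]
    (𝒜 : ℕ → Submodule R S) [GradedAlgebra 𝒜] (I : HomogeneousIdeal 𝒜) :
    GradedAlgebra (quotientGrading 𝒜 I) :=
  GradedAlgebra.ofAlgHom (quotientGrading 𝒜 I)
    (Ideal.Quotient.liftₐ I.toIdeal (quotientGradingAux 𝒜 I) (quotientGradingAux_eq_zero 𝒜 I))
    (by
      classical
      apply Ideal.Quotient.algHom_ext
      ext x
      change DirectSum.coeAlgHom (quotientGrading 𝒜 I) (quotientGradingAux 𝒜 I x) =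
        Ideal.Quotient.mk I.toIdeal x
      conv_lhs => rw [← DirectSum.sum_support_decompose 𝒜 x]
      conv_rhs => rw [← DirectSum.sum_support_decompose 𝒜 x]
      rw [map_sum, map_sum, map_sum]
      refine Finset.sum_congr rfl fun n _ => ?_
      rw [quotientGradingAux_of_mem, DirectSum.coeAlgHom_of]
      rfl)
    (by
      rintro n ⟨_, x, hx, rfl⟩
      exact quotientGradingAux_of_mem 𝒜 I ⟨x, hx⟩)

/-! ## Closed subschemes of projective space -/

/-- A closed subscheme of the projective space `ℙ^σ_A = Proj A[x_i | i ∈ σ]` over a ring `A`, given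
by its ideal: the homogeneous ideals that are saturated with respect to the irrelevant ideal
correspond bijectively to the closed subschemes of `ℙ^σ_A`. For `A = k[t]`, this is a closed
subscheme of `ℙ^σ × 𝔸¹`. -/
structure ProjSubscheme (σ : Type) (A : Type u) [CommRing A] where
  /-- the ideal of all (sums of) forms vanishing on the subscheme -/
  ideal : HomogeneousIdeal (MvPolynomial.homogeneousSubmodule σ A)
  /-- a polynomial that belongs to the ideal on each chart `x_i ≠ 0` belongs to the ideal -/
  saturated : ∀ f : MvPolynomial σ A,
    (∀ i, ∃ n : ℕ, MvPolynomial.X i ^ n * f ∈ ideal) → f ∈ ideal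

namespace ProjSubscheme

variable {σ τ : Type} {A B : Type u} [CommRing A] [CommRing B]

/-- The closed subscheme `Proj (A[x] / I)` of `ℙ^σ_A` defined by a homogeneous ideal `I`.
Its ideal is the saturation of `I`. -/
def zeroScheme (I : HomogeneousIdeal (MvPolynomial.homogeneousSubmodule σ A)) :
    ProjSubscheme σ A where
  ideal :=
    { carrier := {f | ∀ i, ∃ n : ℕ, MvPolynomial.X i ^ n * f ∈ I}
      zero_mem' := fun i => ⟨0, by simp⟩
      add_mem' := by
        intro f g hf hg i
        obtain ⟨a, ha⟩ := hf i
        obtain ⟨b, hb⟩ := hg i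
        refine ⟨a + b, ?_⟩
        have h : (MvPolynomial.X i : MvPolynomial σ A) ^ (a + b) * (f + g) =
            MvPolynomial.X i ^ b * (MvPolynomial.X i ^ a * f) +
              MvPolynomial.X i ^ a * (MvPolynomial.X i ^ b * g) := by ring
        rw [h]
        exact add_mem (I.toIdeal.mul_mem_left _ ha) (I.toIdeal.mul_mem_left _ hb)
      smul_mem' := by
        intro c f hf i
        obtain ⟨a, ha⟩ := hf i
        refine ⟨a, ?_⟩
        rw [smul_eq_mul, mul_left_comm]
        exact I.toIdeal.mul_mem_left _ ha
      is_homogeneous' := by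
        intro d f hf i
        obtain ⟨a, ha⟩ := hf i
        refine ⟨a, ?_⟩
        have hX : (MvPolynomial.X i : MvPolynomial σ A) ^ a ∈
            MvPolynomial.homogeneousSubmodule σ A a := MvPolynomial.isHomogeneous_X_pow i a
        rw [← DirectSum.coe_decompose_mul_add_of_left_mem
          (MvPolynomial.homogeneousSubmodule σ A) hX]
        exact I.isHomogeneous _ ha }
  saturated := by
    intro f hf i
    obtain ⟨n, hn⟩ := hf i
    obtain ⟨m, hm⟩ := hn i
    exact ⟨m + n, by rw [pow_add, mul_assoc]; exact hm⟩

/-- The scheme `Proj (A[x] / I)` underlying a closed subscheme of `ℙ^σ_A`. -/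
def toScheme (Z : ProjSubscheme σ A) : Scheme.{u} :=
  Proj (quotientGrading (MvPolynomial.homogeneousSubmodule σ A) Z.ideal)

/-- The structure morphism of a closed subscheme of `ℙ^σ_A`. -/
def toBase (Z : ProjSubscheme σ A) : Z.toScheme ⟶ Spec (CommRingCat.of A) :=
  Proj.toSpecZero (quotientGrading (MvPolynomial.homogeneousSubmodule σ A) Z.ideal) ≫
    Spec.map (CommRingCat.ofHom (algebraMap A
      (quotientGrading (MvPolynomial.homogeneousSubmodule σ A) Z.ideal 0)))

/-- `Z` and `Z'` are isomorphic as schemes over `Spec A`. -/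
def IsoOverBase (Z : ProjSubscheme σ A) (Z' : ProjSubscheme τ A) : Prop :=
  ∃ e : Z.toScheme ≅ Z'.toScheme, e.hom ≫ Z'.toBase = Z.toBase

/-- The pull-back of a closed subscheme of `ℙ^σ_A` under `ℙ^σ_B → ℙ^σ_A`, where `φ : A → B`. -/
def baseChange (φ : A →+* B) (Z : ProjSubscheme σ A) : ProjSubscheme σ B :=
  zeroScheme (Z.ideal.map
    (ℬ := MvPolynomial.homogeneousSubmodule σ B)
    { MvPolynomial.map φ with
      map_mem := fun hx => MvPolynomial.IsHomogeneous.map hx φ })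

/-- The fibre over `t = a` of a closed subscheme of `ℙ^σ × 𝔸¹`, as a closed subscheme
of `ℙ^σ`. -/
def fiber (𝔛 : ProjSubscheme σ A[X]) (a : A) : ProjSubscheme σ A :=
  𝔛.baseChange (Polynomial.evalRingHom a)

/-- The product family `Z × 𝔸¹ ⊂ ℙ^σ × 𝔸¹`. -/
def prodAffineLine (Z : ProjSubscheme σ A) : ProjSubscheme σ A[X] :=
  Z.baseChange Polynomial.C

/-- The closed subscheme `Z × 𝔾_m` of `ℙ^σ × 𝔾_m`. -/
def prodPuncturedLine (Z : ProjSubscheme σ A) : ProjSubscheme σ A[T;T⁻¹] :=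
  Z.baseChange LaurentPolynomial.C

/-- The restriction to `𝔸¹ - 0` of a closed subscheme of `ℙ^σ × 𝔸¹`. -/
def awayFromZero (𝔛 : ProjSubscheme σ A[X]) : ProjSubscheme σ A[T;T⁻¹] :=
  𝔛.baseChange Polynomial.toLaurent

end ProjSubscheme

/-! ## Maps given by forms of the same degree -/

/-- `f : A[y_j | j ∈ τ] → A[x_i | i ∈ σ]` sends the variables to forms of degree `d`. It is then the
comorphism of the rational map `ℙ^σ ⇢ ℙ^τ` given by the forms `f y_j`. -/
def IsFormsMap {σ τ : Type} {A : Type u} [CommRing A]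
    (f : MvPolynomial τ A →ₐ[A] MvPolynomial σ A) (d : ℕ) : Prop :=
  ∀ j, (f (MvPolynomial.X j)).IsHomogeneous d

theorem IsFormsMap.isHomogeneous {σ τ : Type} {A : Type u} [CommRing A]
    {f : MvPolynomial τ A →ₐ[A] MvPolynomial σ A} {d : ℕ} (hf : IsFormsMap f d)
    {p : MvPolynomial τ A} {n : ℕ} (hp : p.IsHomogeneous n) : (f p).IsHomogeneous (d * n) := by
  have h := hp.aeval (fun j => f (MvPolynomial.X j)) hf
  have e : f = MvPolynomial.aeval (fun j => f (MvPolynomial.X j)) :=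
    MvPolynomial.aeval_unique f
  rwa [← e] at h

theorem IsFormsMap.decompose {σ τ : Type} {A : Type u} [CommRing A]
    {f : MvPolynomial τ A →ₐ[A] MvPolynomial σ A} {d : ℕ} (hd : 0 < d) (hf : IsFormsMap f d)
    (p : MvPolynomial τ A) (n : ℕ) :
    (DirectSum.decompose (MvPolynomial.homogeneousSubmodule σ A) (f p) (d * n) :
        MvPolynomial σ A) =
      f (DirectSum.decompose (MvPolynomial.homogeneousSubmodule τ A) p n) := by
  classical
  induction p using DirectSum.Decomposition.inductionOn
    (MvPolynomial.homogeneousSubmodule τ A) with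
  | zero => simp
  | @homogeneous i m =>
    have hm : f m ∈ MvPolynomial.homogeneousSubmodule σ A (d * i) := hf.isHomogeneous m.2
    by_cases h : i = n
    · subst h
      rw [DirectSum.decompose_of_mem_same _ hm, DirectSum.decompose_of_mem_same _ m.2]
    · rw [DirectSum.decompose_of_mem_ne _ hm (fun h' => h (Nat.eq_of_mul_eq_mul_left hd h')),
        DirectSum.decompose_of_mem_ne _ m.2 h, map_zero]
  | add p p' hp hp' =>
    simp only [map_add, DirectSum.decompose_add, DirectSum.add_apply, Submodule.coe_add, hp, hp']

/-- The preimage of a homogeneous ideal under a map that is given by forms of degree `d > 0`. -/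
def HomogeneousIdeal.comapForms {σ τ : Type} {A : Type u} [CommRing A]
    (f : MvPolynomial τ A →ₐ[A] MvPolynomial σ A) {d : ℕ} (hd : 0 < d) (hf : IsFormsMap f d)
    (I : HomogeneousIdeal (MvPolynomial.homogeneousSubmodule σ A)) :
    HomogeneousIdeal (MvPolynomial.homogeneousSubmodule τ A) where
  toSubmodule := I.toIdeal.comap f
  is_homogeneous' := by
    intro n p hp
    change f _ ∈ I.toIdeal
    rw [← hf.decompose hd]
    exact I.isHomogeneous _ hp

/-- The (scheme-theoretic) image of a closed subscheme of `ℙ^σ` under a morphism `ℙ^σ → ℙ^τ` with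
comorphism `f`: it is defined by all `p` such that `f p` vanishes on the subscheme. -/
def ProjSubscheme.image {σ τ : Type} {A : Type u} [CommRing A]
    (f : MvPolynomial τ A →ₐ[A] MvPolynomial σ A) {d : ℕ} (hd : 0 < d) (hf : IsFormsMap f d)
    (Z : ProjSubscheme σ A) : ProjSubscheme τ A :=
  zeroScheme (Z.ideal.comapForms f hd hf)

/-- The domain of definition of the rational map `ℙ^σ ⇢ ℙ^τ` given by the forms `f y_j`: the
complement of their common zero locus. -/
def formsDomain {σ τ : Type} {A : Type u} [CommRing A] (f : MvPolynomial τ A →ₐ[A] MvPolynomial σ A) :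
    Set (ProjectiveSpectrum (MvPolynomial.homogeneousSubmodule σ A)) :=
  {P | ∃ j, f (MvPolynomial.X j) ∉ P.asHomogeneousIdeal}

/-- The underlying map on points of the rational map `ℙ^σ ⇢ ℙ^τ` given by the forms `f y_j`. -/
def formsMap {σ τ : Type} {A : Type u} [CommRing A]
    (f : MvPolynomial τ A →ₐ[A] MvPolynomial σ A) {d : ℕ} (hd : 0 < d) (hf : IsFormsMap f d)
    (P : formsDomain f) : ProjectiveSpectrum (MvPolynomial.homogeneousSubmodule τ A) where
  asHomogeneousIdeal := P.1.asHomogeneousIdeal.comapForms f hd hf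
  isPrime := P.1.isPrime.comap f
  not_irrelevant_le := by
    intro h
    obtain ⟨j, hj⟩ := P.2
    exact hj (h (HomogeneousIdeal.mem_irrelevant_of_mem _ Nat.one_pos
      (MvPolynomial.isHomogeneous_X A j)))

/-! ## Toric varieties and toric degenerations -/

/-- An action of the torus `𝔾_m^r` on a scheme `W` over a field `k`, as an action
of the group `𝔾_m^r(S) = (Γ(S, 𝒪_S)ˣ)^r` on `W(S)` that is functorial in the `k`-scheme `S`. -/
structure TorusAction (k : Type u) [Field k] (r : ℕ) (W : Over (Spec (CommRingCat.of k))) where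
  /-- the action on `S`-valued points -/
  act : ∀ {S : Over (Spec (CommRingCat.of k))},
    (Fin r → Γ(S.left, ⊤)ˣ) → (S ⟶ W) → (S ⟶ W)
  act_one : ∀ {S : Over (Spec (CommRingCat.of k))} (x : S ⟶ W), act 1 x = x
  act_mul : ∀ {S : Over (Spec (CommRingCat.of k))} (s t : Fin r → Γ(S.left, ⊤)ˣ) (x : S ⟶ W),
    act (s * t) x = act s (act t x)
  act_comp : ∀ {S S' : Over (Spec (CommRingCat.of k))} (h : S' ⟶ S)
    (t : Fin r → Γ(S.left, ⊤)ˣ) (x : S ⟶ W),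
    h ≫ act t x = act (fun i => Units.map h.left.appTop.hom.toMonoidHom (t i)) (h ≫ x)

/-- The torus `𝔾_m^r = Spec k[ℤ^r]` over `k`. -/
def torus (k : Type u) [Field k] (r : ℕ) : Over (Spec (CommRingCat.of k)) :=
  Over.mk (Spec.map (CommRingCat.ofHom (algebraMap k (AddMonoidAlgebra k (Fin r → ℤ)))))

/-- The coordinates of `𝔾_m^r`, as invertible functions. -/
def torusCoord (k : Type u) [Field k] (r : ℕ) (i : Fin r) : Γ((torus k r).left, ⊤)ˣ :=
  Units.map (Scheme.ΓSpecIso (CommRingCat.of (AddMonoidAlgebra k (Fin r → ℤ)))).inv.hom.toMonoidHom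
    (Units.map (AddMonoidAlgebra.of k (Fin r → ℤ))
      (toUnits (Multiplicative.ofAdd (Pi.single i 1))))

/-- The orbit map `𝔾_m^r → W`, `t ↦ t · w`, of a rational point `w` of `W`. -/
def TorusAction.orbitMap {k : Type u} [Field k] {r : ℕ} {W : Over (Spec (CommRingCat.of k))}
    (a : TorusAction k r W) (w : Over.mk (𝟙 (Spec (CommRingCat.of k))) ⟶ W) : torus k r ⟶ W :=
  a.act (torusCoord k r) (Over.homMk (torus k r).hom ≫ w)

/-- An open subscheme `U` of `W` is invariant if `t · x` lies in `U` for all `S`-valued points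
`x` of `U` and `t` of the torus. -/
def TorusAction.IsInvariant {k : Type u} [Field k] {r : ℕ} {W : Over (Spec (CommRingCat.of k))}
    (a : TorusAction k r W) (U : W.left.Opens) : Prop :=
  ∀ (S : Over (Spec (CommRingCat.of k))) (t : Fin r → Γ(S.left, ⊤)ˣ) (x : S ⟶ W),
    Set.range x.left ⊆ U → Set.range (a.act t x).left ⊆ U

namespace ProjSubscheme

variable {σ : Type} {k : Type u} [Field k]

/-- A variety is a reduced and irreducible closed subscheme of `ℙ^σ`. -/
def IsVariety (Z : ProjSubscheme σ k) : Prop := IsIntegral Z.toScheme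

/-- A projective, not necessarily normal, toric variety: a variety with the action of a torus
that has an open dense orbit and an open covering by invariant affine sets. -/
def IsToricVariety (W : ProjSubscheme σ k) : Prop :=
  W.IsVariety ∧ ∃ (r : ℕ) (a : TorusAction k r (Over.mk W.toBase)),
    (∃ w, IsOpen (Set.range (a.orbitMap w).left) ∧ Dense (Set.range (a.orbitMap w).left)) ∧
    ∀ x : W.toScheme, ∃ U : W.toScheme.Opens, x ∈ U ∧ IsAffineOpen U ∧ a.IsInvariant U

/-- `𝔛 ⊂ ℙ^σ × 𝔸¹` is a (flat) degeneration of `X ⊂ ℙ^σ`, the fibre over `1`, to `W ⊂ ℙ^σ`, the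
special fibre over `0`: it is flat and surjective over `𝔸¹`, and isomorphic to the
product `X × (𝔸¹ - 0)` over `𝔸¹ - 0`. -/
structure IsDegeneration (𝔛 : ProjSubscheme σ k[X]) (X W : ProjSubscheme σ k) : Prop where
  flat : Flat 𝔛.toBase
  surjective : Surjective 𝔛.toBase
  iso_away : 𝔛.awayFromZero.IsoOverBase X.prodPuncturedLine
  fiber_one : 𝔛.fiber 1 = X
  fiber_zero : 𝔛.fiber 0 = W

/-- A toric degeneration is a degeneration to a (not necessarily normal) toric variety. -/
structure IsToricDegeneration (𝔛 : ProjSubscheme σ k[X]) (X W : ProjSubscheme σ k) : Prop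
    extends IsDegeneration 𝔛 X W where
  toric : W.IsToricVariety

/-- The degeneration `𝔛` of `X` is trivial if `𝔛 ≅ X × 𝔸¹` over `𝔸¹`. -/
def IsTrivialDegeneration (𝔛 : ProjSubscheme σ k[X]) (X : ProjSubscheme σ k) : Prop :=
  𝔛.IsoOverBase X.prodAffineLine

end ProjSubscheme

/-! ## Veronese embeddings and degenerations by projection -/

/-- The monomials of degree `m` in `x_0, …, x_q`; they index the homogeneous coordinates of the
target `ℙ^N` of the `m`-th Veronese embedding. -/
abbrev Monomials (q m : ℕ) : Type := {α : Fin (q + 1) →₀ ℕ // α.degree = m}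

/-- The comorphism of the `m`-th Veronese embedding `v : ℙ^q → ℙ^N`: the homogeneous coordinate of
`ℙ^N` that belongs to a monomial of degree `m` is sent to that monomial. For `m = 1` the embedding
is the identity. -/
def veronese (k : Type u) [Field k] (q m : ℕ) :
    MvPolynomial (Monomials q m) k →ₐ[k] MvPolynomial (Fin (q + 1)) k :=
  MvPolynomial.aeval fun α => MvPolynomial.monomial α.1 1

theorem veronese_isFormsMap (k : Type u) [Field k] (q m : ℕ) : IsFormsMap (veronese k q m) m := by
  intro α
  rw [veronese, MvPolynomial.aeval_X]
  exact MvPolynomial.isHomogeneous_monomial _ α.2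

/-- A system of homogeneous coordinates `z_i, w_j` (`i ∈ ι`, `j ∈ κ`) on `ℙ^σ`: a basis of the space
of linear forms. It determines the linear subspace `ℙ^ι = {w = 0}` of `ℙ^σ`, the linear projection
`p : ℙ^σ - {z = 0} → ℙ^ι` with centre `{z = 0}`, and the linear action of `𝔾_m` by
`t · (z, w) = (z, t w)`, under which the coordinates `z_i` have weight `0` and
the coordinates `w_j`, as functions, have weight `-1`. -/
abbrev SplitCoordinates (ι κ σ : Type) (k : Type u) [Field k] : Type u :=
  Module.Basis (ι ⊕ κ) k (MvPolynomial.homogeneousSubmodule σ k 1)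

namespace SplitCoordinates

variable {ι κ σ : Type} {k : Type u} [Field k]

/-- The change of coordinates: the comorphism of the isomorphism from `ℙ^σ` to the projective
space with coordinates `z, w`. -/
def coord (ℓ : SplitCoordinates ι κ σ k) : MvPolynomial (ι ⊕ κ) k →ₐ[k] MvPolynomial σ k :=
  MvPolynomial.aeval fun j => (ℓ j : MvPolynomial σ k)

theorem coord_isFormsMap (ℓ : SplitCoordinates ι κ σ k) : IsFormsMap ℓ.coord 1 := by
  intro j
  rw [coord, MvPolynomial.aeval_X]
  exact (ℓ j).2

/-- The comorphism of the projection `p` to `ℙ^ι`. -/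
def projection (ℓ : SplitCoordinates ι κ σ k) : MvPolynomial ι k →ₐ[k] MvPolynomial σ k :=
  MvPolynomial.aeval fun i => (ℓ (Sum.inl i) : MvPolynomial σ k)

theorem projection_isFormsMap (ℓ : SplitCoordinates ι κ σ k) : IsFormsMap ℓ.projection 1 := by
  intro j
  rw [projection, MvPolynomial.aeval_X]
  exact (ℓ (Sum.inl j)).2

end SplitCoordinates

/-- The comorphism of the rational map `p ∘ v : ℙ^q ⇢ ℙ^ι`, the `m`-th Veronese embedding followed
by a linear projection. -/
def veroneseProjection {ι κ : Type} {k : Type u} [Field k] {q m : ℕ}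
    (ℓ : SplitCoordinates ι κ (Monomials q m) k) :
    MvPolynomial ι k →ₐ[k] MvPolynomial (Fin (q + 1)) k :=
  (veronese k q m).comp ℓ.projection

theorem veroneseProjection_isFormsMap {ι κ : Type} {k : Type u} [Field k] {q m : ℕ}
    (ℓ : SplitCoordinates ι κ (Monomials q m) k) : IsFormsMap (veroneseProjection ℓ) m := by
  intro j
  have h := (veronese_isFormsMap k q m).isHomogeneous (ℓ.projection_isFormsMap j)
  rwa [mul_one] at h

/-- The restriction `φ : X - B → W` of `p ∘ v` to `X - B`, where `B ⊂ X` is the locus where `p ∘ v`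
is not defined, is a dominant morphism to `W`: the closure of `φ(X - B)` is `W`. (As `X` and `W` are
reduced, a morphism to `ℙ^ι` maps to `W` as soon as this holds on points.) -/
def IsDominantVeroneseProjection {ι κ : Type} {k : Type u} [Field k] {q m : ℕ} (hm : 0 < m)
    (ℓ : SplitCoordinates ι κ (Monomials q m) k)
    (X : ProjSubscheme (Fin (q + 1)) k) (W : ProjSubscheme ι k) : Prop :=
  closure (formsMap (veroneseProjection ℓ) hm (veroneseProjection_isFormsMap ℓ) ''
      {P | X.ideal ≤ P.1.asHomogeneousIdeal}) =
    {Q | W.ideal ≤ Q.asHomogeneousIdeal}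

namespace ProjSubscheme

variable {ι κ : Type} {k : Type u} [Field k]

/-- The comorphism of `𝔾_m × ℙ^{ι ⊕ κ} → ℙ^{ι ⊕ κ}`, `(t, (z, w)) ↦ t⁻¹ · (z, w) = (z, t⁻¹ w)`. -/
def scaling (ι κ : Type) (k : Type u) [Field k] :
    GradedRingHom (MvPolynomial.homogeneousSubmodule (ι ⊕ κ) k)
      (MvPolynomial.homogeneousSubmodule (ι ⊕ κ) k[T;T⁻¹]) where
  toRingHom := MvPolynomial.eval₂Hom (MvPolynomial.C.comp LaurentPolynomial.C)
    (Sum.elim (fun i => MvPolynomial.X (Sum.inl i))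
      (fun j => MvPolynomial.C (LaurentPolynomial.T (-1)) * MvPolynomial.X (Sum.inr j)))
  map_mem := by
    intro n p hp
    have h := MvPolynomial.IsHomogeneous.eval₂ (n := 1) hp
      (MvPolynomial.C.comp LaurentPolynomial.C)
      (Sum.elim (fun i => MvPolynomial.X (Sum.inl i))
        (fun j => MvPolynomial.C (LaurentPolynomial.T (-1)) * MvPolynomial.X (Sum.inr j)) :
        ι ⊕ κ → MvPolynomial (ι ⊕ κ) k[T;T⁻¹])
      (fun c => MvPolynomial.isHomogeneous_C _ _)
      (by
        rintro (i | j)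
        · exact MvPolynomial.isHomogeneous_X _ _
        · exact MvPolynomial.isHomogeneous_C_mul_X _ _)
    rwa [one_mul] at h

/-- The degeneration by projection of `Z ⊂ ℙ^{ι ⊕ κ}`: the closure of
`𝔾_m · Z = {(t · x, t) | x ∈ Z} ⊂ ℙ^{ι ⊕ κ} × 𝔾_m` in `ℙ^{ι ⊕ κ} × 𝔸¹`. The ideal
of `𝔾_m · Z` is generated by the polynomials `f (z, t⁻¹ w)` with `f (z, w)` in the ideal of `Z`, and
the ideal of its closure is the contraction to `k[t][z, w]`. -/
def degenerationByProjection (Z : ProjSubscheme (ι ⊕ κ) k) : ProjSubscheme (ι ⊕ κ) k[X] :=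
  zeroScheme ((Z.ideal.map (scaling ι κ k)).comap
    (𝒜 := MvPolynomial.homogeneousSubmodule (ι ⊕ κ) k[X])
    { MvPolynomial.map Polynomial.toLaurent with
      map_mem := fun hx => MvPolynomial.IsHomogeneous.map hx _ })

/-- The intersection of a closed subscheme of `ℙ^{ι ⊕ κ}` with `ℙ^ι = {w = 0}`, as a closed
subscheme of `ℙ^ι`. -/
def linearSection (Z : ProjSubscheme (ι ⊕ κ) k) : ProjSubscheme ι k :=
  zeroScheme (Z.ideal.map
    (ℬ := MvPolynomial.homogeneousSubmodule ι k)
    { (MvPolynomial.aeval (Sum.elim MvPolynomial.X 0) :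
        MvPolynomial (ι ⊕ κ) k →ₐ[k] MvPolynomial ι k).toRingHom with
      map_mem := by
        intro n p hp
        have h := MvPolynomial.IsHomogeneous.aeval (n := 1) hp
          (Sum.elim MvPolynomial.X 0 : ι ⊕ κ → MvPolynomial ι k)
          (by
            rintro (i | j)
            · exact MvPolynomial.isHomogeneous_X _ _
            · exact MvPolynomial.isHomogeneous_zero _ _ _)
        rwa [one_mul] at h })

/-- The image `v(X) ⊂ ℙ^N` of `X ⊂ ℙ^q` under the `m`-th Veronese embedding, in the homogeneous
coordinates `ℓ` of `ℙ^N`. -/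
def veroneseImage {q m : ℕ} (hm : 0 < m) (ℓ : SplitCoordinates ι κ (Monomials q m) k)
    (X : ProjSubscheme (Fin (q + 1)) k) : ProjSubscheme (ι ⊕ κ) k :=
  (X.image (veronese k q m) hm (veronese_isFormsMap k q m)).image
    ℓ.coord Nat.one_pos ℓ.coord_isFormsMap

end ProjSubscheme

end

open MvPolynomial (homogeneousSubmodule)

noncomputable section

attribute [local instance] MvPolynomial.gradedAlgebra

/-! ## Charts of `Proj` and integrality -/

section Charts

open HomogeneousLocalization

variable {R τ : Type u} [CommRing R] [SetLike τ R] [AddSubgroupClass τ R]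
  (𝒜 : ℕ → τ) [GradedRing 𝒜]

/-! Everything is read off from Hilbert functions $H$ of homogeneous coordinate rings. By flatness
the coordinate ring of $\mathfrak X$ has no torsion over $k[t]$, so $H_W(d)=H_X(d)$ for large $d$
(`ProjSubscheme.exists_hilbertFunction_fiber_eq`). The family $\mathfrak X'$ is cut out by the
kernel of a map to a domain, $F\mapsto F(z,tw,t)$ on $v(X)$
(`ProjSubscheme.mem_degenerationByProjection_ideal_iff`), so it has no torsion either and
$H_{X'}(d)=H_{v(X)}(d)=H_X(md)$ for large $d$.

Let $m\ge 2$ and suppose that $X'$ is a variety. If all $w_j$ vanish on $X'$, then $X'$ has the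
ideal of $W$ in $\mathbb P^q$, so $H_X(md)=H_X(d)$ for large $d$. Then $H_X$ is eventually constant
and $X$ is a point, contrary to its positive dimension. If some $w_j$ does not vanish on $X'$, a
relation $\sum_{e\le n} w_j^e p_e(z)=0$ on $v(X)$ yields the equation $w_j^n p_n(z)=0$ of $X'$; as
$X'$ is integral, $p_n$ vanishes on $W$. By descent $w_j$ is transcendental over the coordinate ring
of $W$, so $\sum_{e\le d}H_W(e)\le H_X(md)$, which is too fast for a function of polynomial growth
(`false_of_sum_le_of_le_pow`). No dimension theory is needed.

For $m=1$ the $q+1$ coordinates $z$ already span the linear forms, so there are no $w$: nothing is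
moved, $\mathfrak X'$ is trivial and $X'$ is integral. The second claim follows, since an
isomorphism over $\mathbb A^1$ identifies the fibres $W$ and $X'$ and hence forces $m=1$. For the
third claim, setting $t=0$ in $F(z,tw,t)$ kills the $w$, and equations in $z$ alone are independent
of $t$. -/

theorem away_mk_eq_zero_iff {f : R} {d : ℕ} (hf : f ∈ 𝒜 d) (n : ℕ) (a : R) (ha : a ∈ 𝒜 (n • d)) :
    Away.mk 𝒜 hf n a ha = 0 ↔ ∃ m : ℕ, f ^ m * a = 0 := by
  rw [HomogeneousLocalization.ext_iff_val, Away.val_mk, HomogeneousLocalization.val_zero,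
    Localization.mk_eq_mk', IsLocalization.mk'_eq_zero_iff]
  constructor
  · rintro ⟨⟨_, m, rfl⟩, h⟩
    exact ⟨m, h⟩
  · rintro ⟨m, h⟩
    exact ⟨⟨f ^ m, m, rfl⟩, h⟩

theorem isDomain_away_of_isIntegral [IsIntegral (Proj 𝒜)] {f : R} {d : ℕ} (hf : f ∈ 𝒜 d)
    (hd : 0 < d) [Nontrivial (Away 𝒜 f)] : IsDomain (Away 𝒜 f) := by
  have : Nonempty (Spec (CommRingCat.of (Away 𝒜 f))) :=
    inferInstanceAs (Nonempty (PrimeSpectrum (Away 𝒜 f)))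
  have := isIntegral_of_isOpenImmersion (Proj.awayι 𝒜 f hf hd)
  exact (affine_isIntegral_iff (CommRingCat.of (Away 𝒜 f))).mp this

theorem nonempty_basicOpen_of_nontrivial_away {f : R} {d : ℕ} (hf : f ∈ 𝒜 d) (hd : 0 < d)
    [Nontrivial (Away 𝒜 f)] : ((Proj.basicOpen 𝒜 f : (Proj 𝒜).Opens) : Set (Proj 𝒜)).Nonempty := by
  have : Nonempty (Spec (CommRingCat.of (Away 𝒜 f))) :=
    inferInstanceAs (Nonempty (PrimeSpectrum (Away 𝒜 f)))
  rw [← Proj.opensRange_awayι 𝒜 f hf hd]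
  exact Set.range_nonempty _

/-- In the homogeneous coordinate ring of an integral `Proj`, a product of two forms vanishes only
if one of them is zero on all charts. -/
theorem exists_pow_mul_eq_zero_of_isIntegral [IsIntegral (Proj 𝒜)] {ι : Type*} (x : ι → R)
    (hx : ∀ i, x i ∈ 𝒜 1) {a b : R} {d e : ℕ} (ha : a ∈ 𝒜 d) (hb : b ∈ 𝒜 e) (hab : a * b = 0) :
    (∀ i, ∃ n : ℕ, x i ^ n * a = 0) ∨ ∀ i, ∃ n : ℕ, x i ^ n * b = 0 := by
  by_contra! h
  obtain ⟨⟨i, hi⟩, j, hj⟩ := h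
  have ha' : a ∈ 𝒜 (d • 1) := by simpa using ha
  have hb' : b ∈ 𝒜 (e • 1) := by simpa using hb
  have hx' : ∀ l, x l ∈ 𝒜 (1 • 1) := fun l => by simpa using hx l
  have hai : Away.mk 𝒜 (hx i) d a ha' ≠ 0 := fun h =>
    let ⟨n, hn⟩ := (away_mk_eq_zero_iff 𝒜 _ _ _ _).mp h; hi n hn
  have hbj : Away.mk 𝒜 (hx j) e b hb' ≠ 0 := fun h =>
    let ⟨n, hn⟩ := (away_mk_eq_zero_iff 𝒜 _ _ _ _).mp h; hj n hn
  have := nontrivial_of_ne _ _ hai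
  have := nontrivial_of_ne _ _ hbj
  have := isDomain_away_of_isIntegral 𝒜 (hx i) one_pos
  have := isDomain_away_of_isIntegral 𝒜 (hx j) one_pos
  -- The forms `a` and `b` may be nonzero on different charts; irreducibility gives a common point
  -- of the two charts, through which `b` is carried to the chart of `a`.
  obtain ⟨P, hPi, hPj⟩ := nonempty_preirreducible_inter
    (Proj.basicOpen 𝒜 (x i)).2 (Proj.basicOpen 𝒜 (x j)).2
    (nonempty_basicOpen_of_nontrivial_away 𝒜 (hx i) one_pos)
    (nonempty_basicOpen_of_nontrivial_away 𝒜 (hx j) one_pos)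
  replace hPi : x i ∉ P.asHomogeneousIdeal := hPi
  replace hPj : x j ∉ P.asHomogeneousIdeal := hPj
  have hxij : Away.mk 𝒜 (hx j) 1 (x i) (hx' i) ≠ 0 := by
    intro h
    obtain ⟨n, hn⟩ := (away_mk_eq_zero_iff 𝒜 _ _ _ _).mp h
    have h0 : x j ^ n * x i ∈ P.asHomogeneousIdeal.toIdeal := by rw [hn]; exact zero_mem _
    rcases P.isPrime.mem_or_mem h0 with h1 | h1
    · exact hPj (P.isPrime.mem_of_pow_mem _ h1)
    · exact hPi h1
  have hbi : Away.mk 𝒜 (hx i) e b hb' ≠ 0 := by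
    intro h
    obtain ⟨n, hn⟩ := (away_mk_eq_zero_iff 𝒜 _ _ _ _).mp h
    -- A power of `x i` that kills `b` would give a vanishing product of nonzero fractions in the
    -- domain of chart `j`.
    refine mul_ne_zero (pow_ne_zero n hxij) hbj ?_
    apply HomogeneousLocalization.val_injective
    simp only [val_mul, val_pow, Away.val_mk, val_zero, Localization.mk_pow, Localization.mk_mul, hn,
      Localization.mk_zero]
  refine mul_ne_zero hai hbi ?_
  apply HomogeneousLocalization.val_injective
  simp only [val_mul, Away.val_mk, val_zero, Localization.mk_mul, hab, Localization.mk_zero]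

/-- The zero ideal is a generic point: the nonzero form `f` of positive degree keeps it from
containing the irrelevant ideal. Reducedness is checked on the charts. -/
theorem isIntegral_proj_of_isDomain [IsDomain R] {f : R} {d : ℕ} (hf : f ∈ 𝒜 d) (hd : 0 < d)
    (hf0 : f ≠ 0) : IsIntegral (Proj 𝒜) := by
  have hred : AlgebraicGeometry.IsReduced (Proj 𝒜) := by
    have (i : (Proj.affineOpenCover 𝒜).openCover.I₀) :
        AlgebraicGeometry.IsReduced ((Proj.affineOpenCover 𝒜).openCover.X i) := by
      change AlgebraicGeometry.IsReduced (Spec (CommRingCat.of (Away 𝒜 (i.2 : R))))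
      have : _root_.IsReduced (Away 𝒜 (i.2 : R)) := by
        refine ⟨fun z hz => ?_⟩
        obtain ⟨n, hn⟩ := hz
        obtain ⟨m, a, ha, rfl⟩ := Away.mk_surjective 𝒜 i.2.2 z
        apply HomogeneousLocalization.val_injective
        have h := congrArg HomogeneousLocalization.val hn
        simp only [val_pow, Away.val_mk, val_zero, Localization.mk_pow] at h ⊢
        rw [Localization.mk_eq_mk', IsLocalization.mk'_eq_zero_iff] at h ⊢
        obtain ⟨⟨_, r, rfl⟩, hr⟩ := h
        rcases mul_eq_zero.mp hr with h | h
        · exact ⟨⟨_, r, rfl⟩, by simp only at h ⊢; rw [h, zero_mul]⟩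
        · exact ⟨1, by rw [eq_zero_of_pow_eq_zero h, mul_zero]⟩
      infer_instance
    exact IsReduced.of_openCover (X := Proj 𝒜) (Proj.affineOpenCover 𝒜).openCover
  let η : ProjectiveSpectrum 𝒜 :=
    { asHomogeneousIdeal := ⊥
      isPrime := by
        rw [HomogeneousIdeal.toIdeal_bot]
        exact Ideal.isPrime_bot
      not_irrelevant_le := fun h =>
        hf0 (by
          have hf' : f ∈ (⊥ : HomogeneousIdeal 𝒜).toIdeal :=
            h (HomogeneousIdeal.mem_irrelevant_of_mem _ hd hf)
          rwa [HomogeneousIdeal.toIdeal_bot, Ideal.mem_bot] at hf') }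
  have hη : closure {η} = Set.univ := Set.eq_univ_of_forall fun P =>
    (ProjectiveSpectrum.le_iff_mem_closure 𝒜 η P).mp
      ((ProjectiveSpectrum.as_ideal_le_as_ideal 𝒜 η P).mp bot_le)
  have hirr : IrreducibleSpace (Proj 𝒜) := by
    have : IsIrreducible (Set.univ : Set (ProjectiveSpectrum 𝒜)) := by
      rw [← hη]
      exact isIrreducible_singleton.closure
    exact (irreducibleSpace_def _).mpr this
  exact isIntegral_of_irreducibleSpace_of_isReduced _

end Charts

/-! ## Varieties and prime ideals -/

namespace ProjSubscheme

variable {σ τ : Type} {A B : Type u} [CommRing A] [CommRing B]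

/-- The homogeneous coordinates of a closed subscheme. -/
def coordinate (Z : ProjSubscheme σ A) (i : σ) : MvPolynomial σ A ⧸ Z.ideal.toIdeal :=
  Ideal.Quotient.mk _ (MvPolynomial.X i)

theorem mk_mem_quotientGrading (I : HomogeneousIdeal (homogeneousSubmodule σ A))
    {p : MvPolynomial σ A} {n : ℕ} (hp : p.IsHomogeneous n) :
    Ideal.Quotient.mk I.toIdeal p ∈ quotientGrading (homogeneousSubmodule σ A) I n :=
  ⟨p, hp, rfl⟩

theorem coordinate_mem (Z : ProjSubscheme σ A) (i : σ) :
    Z.coordinate i ∈ quotientGrading (homogeneousSubmodule σ A) Z.ideal 1 :=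
  mk_mem_quotientGrading _ (MvPolynomial.isHomogeneous_X A i)

theorem irrelevant_le_span (Z : ProjSubscheme σ A) :
    (HomogeneousIdeal.irrelevant
      (quotientGrading (homogeneousSubmodule σ A) Z.ideal)).toIdeal ≤
      Ideal.span (Set.range Z.coordinate) := by
  rw [HomogeneousIdeal.toIdeal_irrelevant_le]
  rintro n hn _ ⟨p, hp, rfl⟩
  rw [p.as_sum, map_sum]
  refine Ideal.sum_mem _ fun d hd => ?_
  have hd' : d.degree = n := by
    have := hp (MvPolynomial.mem_support_iff.mp hd)
    rw [← this, Finsupp.degree_eq_weight_one]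
    rfl
  obtain ⟨i, hi⟩ : ∃ i, d i ≠ 0 := by
    by_contra! h
    have : d = 0 := Finsupp.ext h
    rw [this, map_zero] at hd'
    exact hn.ne hd'
  have hmul : MvPolynomial.monomial d (p.coeff d) =
      MvPolynomial.monomial (d - Finsupp.single i 1) (p.coeff d) * MvPolynomial.X i := by
    rw [MvPolynomial.X, MvPolynomial.monomial_mul, mul_one, tsub_add_cancel_of_le]
    rwa [Finsupp.single_le_iff, Nat.one_le_iff_ne_zero]
  rw [hmul]
  change Ideal.Quotient.mk Z.ideal.toIdeal _ ∈ _
  rw [map_mul]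
  exact Ideal.mul_mem_left _ _ (Ideal.subset_span ⟨i, rfl⟩)

/-- The standard affine charts of a closed subscheme of projective space. -/
def charts (Z : ProjSubscheme σ A) : Z.toScheme.AffineOpenCover :=
  Proj.affineOpenCoverOfIrrelevantLESpan _ Z.coordinate (m := fun _ => 1) Z.coordinate_mem
    (fun _ => one_pos) Z.irrelevant_le_span

/-- A prime that omits a variable is already saturated. This removes the saturation from every
construction below whose ideal is the kernel of a map to a domain. -/
theorem zeroScheme_ideal_eq_of_isPrime {I : HomogeneousIdeal (homogeneousSubmodule σ A)}
    (hI : I.toIdeal.IsPrime) (h : ∃ i, MvPolynomial.X i ∉ I) : (zeroScheme I).ideal = I := by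
  obtain ⟨i, hi⟩ := h
  ext f
  constructor
  · intro hf
    obtain ⟨n, hn⟩ := hf i
    exact (hI.mem_or_mem hn).resolve_left fun h => hi (hI.mem_of_pow_mem _ h)
  · exact fun hf i => ⟨0, I.toIdeal.mul_mem_left _ hf⟩

theorem le_zeroScheme_ideal (I : HomogeneousIdeal (homogeneousSubmodule σ A)) :
    I ≤ (zeroScheme I).ideal :=
  fun _ hf _ => ⟨0, I.toIdeal.mul_mem_left _ hf⟩

theorem zeroScheme_ideal_self (Z : ProjSubscheme σ A) : (zeroScheme Z.ideal).ideal = Z.ideal :=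
  le_antisymm (fun f hf => Z.saturated f hf) (le_zeroScheme_ideal _)

theorem ext_ideal {Z Z' : ProjSubscheme σ A} (h : Z.ideal = Z'.ideal) : Z = Z' := by
  cases Z
  cases Z'
  congr

/-- Saturation turns vanishing on all charts into membership in the ideal, so integrality of the
scheme becomes primality for forms, which suffices for homogeneous ideals. The omitted variable
supplies a nonempty chart. -/
theorem isIntegral_toScheme_iff (Z : ProjSubscheme σ A) :
    IsIntegral Z.toScheme ↔ Z.ideal.toIdeal.IsPrime ∧ ∃ i, MvPolynomial.X i ∉ Z.ideal := by
  constructor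
  · intro h
    have hX : ∃ i, MvPolynomial.X i ∉ Z.ideal := by
      by_contra! h0
      obtain ⟨P⟩ := h.nonempty
      refine ProjectiveSpectrum.not_irrelevant_le P fun a ha => ?_
      have hspan : Ideal.span (Set.range Z.coordinate) = ⊥ := by
        rw [Ideal.span_eq_bot]
        rintro _ ⟨i, rfl⟩
        exact Ideal.Quotient.eq_zero_iff_mem.mpr (h0 i)
      have ha' := Z.irrelevant_le_span ha
      rw [hspan, Ideal.mem_bot] at ha'
      rw [ha']
      exact zero_mem _
    refine ⟨Ideal.IsHomogeneous.isPrime_of_homogeneous_mem_or_mem Z.ideal.isHomogeneous ?_ ?_, hX⟩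
    · obtain ⟨i, hi⟩ := hX
      exact fun h => hi (h.symm ▸ Submodule.mem_top : MvPolynomial.X i ∈ Z.ideal.toIdeal)
    · rintro a b ⟨d, ha⟩ ⟨e, hb⟩ hab
      have : IsIntegral (Proj (quotientGrading (homogeneousSubmodule σ A) Z.ideal)) := h
      have key := exists_pow_mul_eq_zero_of_isIntegral
        (quotientGrading (homogeneousSubmodule σ A) Z.ideal) Z.coordinate Z.coordinate_mem
        (mk_mem_quotientGrading Z.ideal ha) (mk_mem_quotientGrading Z.ideal hb)
        (by rw [← map_mul]; exact Ideal.Quotient.eq_zero_iff_mem.mpr hab)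
      have (c : MvPolynomial σ A)
          (hc : ∀ i, ∃ n : ℕ, Z.coordinate i ^ n * Ideal.Quotient.mk Z.ideal.toIdeal c = 0) :
          c ∈ Z.ideal.toIdeal := by
        refine Z.saturated c fun i => ?_
        obtain ⟨n, hn⟩ := hc i
        refine ⟨n, Ideal.Quotient.eq_zero_iff_mem.mp ?_⟩
        rw [map_mul, map_pow]
        exact hn
      exact key.imp (this a) (this b)
  · rintro ⟨h, i, hi⟩
    have : IsDomain (MvPolynomial σ A ⧸ Z.ideal.toIdeal) := Ideal.Quotient.isDomain _
    exact isIntegral_proj_of_isDomain _ (Z.coordinate_mem i) one_pos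
      fun h => hi (Ideal.Quotient.eq_zero_iff_mem.mp h)

theorem isVariety_iff {k : Type u} [Field k] (Z : ProjSubscheme σ k) :
    Z.IsVariety ↔ Z.ideal.toIdeal.IsPrime ∧ ∃ i, MvPolynomial.X i ∉ Z.ideal :=
  Z.isIntegral_toScheme_iff

/-! ## Flatness -/

/-- The map from the base ring to the ring of a chart. -/
def chartAlgebraMap (Z : ProjSubscheme σ A) (x : MvPolynomial σ A ⧸ Z.ideal.toIdeal) :
    A →+* HomogeneousLocalization.Away (quotientGrading (homogeneousSubmodule σ A) Z.ideal) x :=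
  (HomogeneousLocalization.fromZeroRingHom
    (quotientGrading (homogeneousSubmodule σ A) Z.ideal) (Submonoid.powers x)).comp
      (algebraMap A (quotientGrading (homogeneousSubmodule σ A) Z.ideal 0))

theorem val_chartAlgebraMap (Z : ProjSubscheme σ A) (x : MvPolynomial σ A ⧸ Z.ideal.toIdeal)
    (a : A) : (Z.chartAlgebraMap x a).val =
      Localization.mk (Ideal.Quotient.mk Z.ideal.toIdeal (MvPolynomial.C a)) 1 := rfl

theorem awayι_toBase (Z : ProjSubscheme σ A) {x : MvPolynomial σ A ⧸ Z.ideal.toIdeal} {n : ℕ}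
    (hx : x ∈ quotientGrading (homogeneousSubmodule σ A) Z.ideal n) (hn : 0 < n) :
    Proj.awayι _ x hx hn ≫ Z.toBase = Spec.map (CommRingCat.ofHom (Z.chartAlgebraMap x)) := by
  unfold toBase
  erw [Proj.awayι_toSpecZero_assoc]
  rw [← Spec.map_comp]
  rfl

/-- The homogeneous coordinate ring of a closed subscheme that is flat over the base has
no torsion. -/
theorem mem_ideal_of_C_mul_mem_of_flat (Z : ProjSubscheme σ A) (hZ : Flat Z.toBase) {a : A}
    (ha : a ∈ nonZeroDivisors A) {f : MvPolynomial σ A} (hf : MvPolynomial.C a * f ∈ Z.ideal) :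
    f ∈ Z.ideal := by
  classical
  -- For a form `g`, flatness makes `a` a nonzerodivisor on each chart, so the fractions of `g`
  -- vanish there, and saturation puts `g` into the ideal.
  have key (d : ℕ) (g : MvPolynomial σ A) (hg : g.IsHomogeneous d)
      (hag : MvPolynomial.C a * g ∈ Z.ideal) : g ∈ Z.ideal := by
    refine Z.saturated g fun i => ?_
    have : @Flat (Proj (quotientGrading (homogeneousSubmodule σ A) Z.ideal)) _ Z.toBase := hZ
    have hflat := Flat.comp (Proj.awayι _ (Z.coordinate i) (Z.coordinate_mem i) one_pos) Z.toBase
    rw [awayι_toBase, Flat.SpecMap_iff, CommRingCat.hom_ofHom] at hflat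
    let φ := Z.chartAlgebraMap (Z.coordinate i)
    let := RingHom.toAlgebra φ
    have : Module.Flat A (HomogeneousLocalization.Away
      (quotientGrading (homogeneousSubmodule σ A) Z.ideal) (Z.coordinate i)) := hflat
    have hreg : IsSMulRegular (HomogeneousLocalization.Away
      (quotientGrading (homogeneousSubmodule σ A) Z.ideal) (Z.coordinate i)) (φ a) :=
      IsSMulRegular.of_flat (Module.Flat.isSMulRegular_of_nonZeroDivisors ha)
    have hg' : Ideal.Quotient.mk Z.ideal.toIdeal g ∈
        quotientGrading (homogeneousSubmodule σ A) Z.ideal (d • 1) := by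
      simpa using mk_mem_quotientGrading Z.ideal hg
    have h0 : φ a • HomogeneousLocalization.Away.mk _ (Z.coordinate_mem i) d _ hg' = 0 := by
      apply HomogeneousLocalization.val_injective
      have hφ : (φ a).val =
        Localization.mk (algebraMap A (MvPolynomial σ A ⧸ Z.ideal.toIdeal) a) 1 := rfl
      rw [smul_eq_mul, HomogeneousLocalization.val_mul, hφ, HomogeneousLocalization.Away.val_mk]
      have : algebraMap A (MvPolynomial σ A ⧸ Z.ideal.toIdeal) a *
          Ideal.Quotient.mk Z.ideal.toIdeal g = 0 :=
        Ideal.Quotient.eq_zero_iff_mem.mpr hag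
      rw [Localization.mk_mul, this, Localization.mk_zero, HomogeneousLocalization.val_zero]
    obtain ⟨n, hn⟩ := (away_mk_eq_zero_iff _ _ _ _ _).mp
      (hreg (h0.trans (mul_zero (φ a)).symm))
    refine ⟨n, Ideal.Quotient.eq_zero_iff_mem.mp ?_⟩
    rw [map_mul, map_pow]
    exact hn
  rw [← DirectSum.sum_support_decompose (homogeneousSubmodule σ A) f]
  refine sum_mem fun d _ => key d _ (DirectSum.decompose (homogeneousSubmodule σ A) f d).2 ?_
  -- Constants have degree 0, so multiplication by `a` respects homogeneous components.
  have hC : (MvPolynomial.C a : MvPolynomial σ A) ∈ homogeneousSubmodule σ A 0 :=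
    MvPolynomial.isHomogeneous_C σ a
  have := Z.ideal.isHomogeneous d hf
  rwa [← zero_add d, DirectSum.coe_decompose_mul_add_of_left_mem _ hC] at this

end ProjSubscheme

/-! ## Morphisms between closed subschemes of projective spaces -/

theorem HomogeneousLocalization.val_sum {R τ ι κ : Type*} [CommRing R] [SetLike τ R]
    [AddSubgroupClass τ R] [AddCommMonoid ι] [DecidableEq ι] {𝒜 : ι → τ} [GradedRing 𝒜]
    {x : Submonoid R} (s : Finset κ) (f : κ → HomogeneousLocalization 𝒜 x) :
    (∑ i ∈ s, f i).val = ∑ i ∈ s, (f i).val := by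
  classical
  induction s using Finset.induction_on with
  | empty => simp only [Finset.sum_empty, HomogeneousLocalization.val_zero]
  | insert a s ha ih =>
    rw [Finset.sum_insert ha, Finset.sum_insert ha, HomogeneousLocalization.val_add, ih]

namespace ProjSubscheme

open HomogeneousLocalization

variable {σ τ : Type} {A B : Type u} [CommRing A] [CommRing B]

/-- The homomorphism of homogeneous coordinate rings induced by a graded ring homomorphism. -/
def coordinateRingHom (g : GradedRingHom (homogeneousSubmodule σ A) (homogeneousSubmodule τ B))
    (I : HomogeneousIdeal (homogeneousSubmodule σ A))
    (J : HomogeneousIdeal (homogeneousSubmodule τ B)) (h : I ≤ J.comap g) :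
    GradedRingHom (quotientGrading (homogeneousSubmodule σ A) I)
      (quotientGrading (homogeneousSubmodule τ B) J) where
  toRingHom := Ideal.quotientMap J.toIdeal g.toRingHom h
  map_mem := by
    rintro n _ ⟨p, hp, rfl⟩
    exact ⟨g p, g.map_mem hp, rfl⟩

/-! ### Base change and fibre products. -/

/-- The extension of scalars, as a homomorphism of graded rings. -/
def scalarExtension (σ : Type) (φ : A →+* B) :
    GradedRingHom (homogeneousSubmodule σ A) (homogeneousSubmodule σ B) :=
  { MvPolynomial.map φ with
    map_mem := fun hx => MvPolynomial.IsHomogeneous.map hx φ }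

theorem scalarExtension_apply (φ : A →+* B) (p : MvPolynomial σ A) :
    scalarExtension σ φ p = MvPolynomial.map φ p := rfl

theorem le_comap_baseChange (φ : A →+* B) (Z : ProjSubscheme σ A) :
    Z.ideal ≤ (Z.baseChange φ).ideal.comap (scalarExtension σ φ) :=
  HomogeneousIdeal.le_comap_of_map_le _ (le_zeroScheme_ideal _)

/-- The homomorphism of homogeneous coordinate rings belonging to a base change. -/
def baseChangeHom (φ : A →+* B) (Z : ProjSubscheme σ A) :
    GradedRingHom (quotientGrading (homogeneousSubmodule σ A) Z.ideal)
      (quotientGrading (homogeneousSubmodule σ B) (Z.baseChange φ).ideal) :=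
  coordinateRingHom (scalarExtension σ φ) _ _ (Z.le_comap_baseChange φ)

theorem baseChangeHom_coordinate (φ : A →+* B) (Z : ProjSubscheme σ A) (i : σ) :
    Z.baseChangeHom φ (Z.coordinate i) = (Z.baseChange φ).coordinate i := by
  change Ideal.Quotient.mk _ (MvPolynomial.map φ (MvPolynomial.X i)) = _
  rw [MvPolynomial.map_X]
  rfl

theorem irrelevant_le_map_baseChangeHom (φ : A →+* B) (Z : ProjSubscheme σ A) :
    HomogeneousIdeal.irrelevant
        (quotientGrading (homogeneousSubmodule σ B) (Z.baseChange φ).ideal) ≤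
      (HomogeneousIdeal.irrelevant
        (quotientGrading (homogeneousSubmodule σ A) Z.ideal)).map (Z.baseChangeHom φ) := by
  refine (Z.baseChange φ).irrelevant_le_span.trans (Ideal.span_le.mpr ?_)
  rintro _ ⟨i, rfl⟩
  rw [← baseChangeHom_coordinate]
  exact Ideal.mem_map_of_mem _ (HomogeneousIdeal.mem_irrelevant_of_mem _ one_pos (Z.coordinate_mem i))

/-- The morphism from a base change to the original scheme. -/
def baseChangeMap (φ : A →+* B) (Z : ProjSubscheme σ A) : (Z.baseChange φ).toScheme ⟶ Z.toScheme :=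
  Proj.map (Z.baseChangeHom φ) (Z.irrelevant_le_map_baseChangeHom φ)

theorem isPullback_chart (φ : A →+* B) (Z : ProjSubscheme σ A) (i : σ) :
    IsPullback
      (Spec.map (CommRingCat.ofHom (Away.map (Z.baseChangeHom φ) (Z.coordinate i))))
      (Proj.awayι _ (Z.baseChangeHom φ (Z.coordinate i))
        ((Z.baseChangeHom φ).map_mem (Z.coordinate_mem i)) one_pos)
      (Proj.awayι _ (Z.coordinate i) (Z.coordinate_mem i) one_pos)
      (Z.baseChangeMap φ) := by
  refine IsOpenImmersion.isPullback _ _ _ _ (Proj.awayι_comp_map _ _ one_pos _ _) ?_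
  rw [Proj.opensRange_awayι, Proj.opensRange_awayι]
  rfl

theorem exists_homogeneous_lift (φ : A →+* B) (hφ : Function.Surjective φ) {n : ℕ}
    {q : MvPolynomial σ B} (hq : q.IsHomogeneous n) :
    ∃ p : MvPolynomial σ A, p.IsHomogeneous n ∧ MvPolynomial.map φ p = q := by
  classical
  obtain ⟨p, rfl⟩ := MvPolynomial.map_surjective φ hφ q
  refine ⟨DirectSum.decompose (homogeneousSubmodule σ A) p n,
    (DirectSum.decompose (homogeneousSubmodule σ A) p n).2, ?_⟩
  have h := (scalarExtension σ φ).map_directSumDecompose (x := p) (i := n)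
  rw [scalarExtension_apply, scalarExtension_apply] at h
  rw [h]
  exact DirectSum.decompose_of_mem_same _ hq

theorem mem_ideal_map_iff_of_surjective (φ : A →+* B) (hφ : Function.Surjective φ)
    (I : HomogeneousIdeal (homogeneousSubmodule σ A)) (q : MvPolynomial σ B) :
    q ∈ I.map (scalarExtension σ φ) ↔ ∃ p ∈ I, MvPolynomial.map φ p = q :=
  Ideal.mem_map_iff_of_surjective (MvPolynomial.map φ) (MvPolynomial.map_surjective φ hφ)

/-- The fraction `p / x_i ^ n` on the chart `x_i ≠ 0`, where `p` is a form of degree `n`. -/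
def fraction (Z : ProjSubscheme σ A) (i : σ) {n : ℕ} (p : MvPolynomial σ A)
    (hp : p.IsHomogeneous n) :
    Away (quotientGrading (homogeneousSubmodule σ A) Z.ideal) (Z.coordinate i) :=
  Away.mk _ (Z.coordinate_mem i) n (Ideal.Quotient.mk _ p)
    (mk_mem_quotientGrading _ (by rwa [smul_eq_mul, mul_one]))

theorem val_fraction (Z : ProjSubscheme σ A) (i : σ) {n : ℕ} (p : MvPolynomial σ A)
    (hp : p.IsHomogeneous n) : (Z.fraction i p hp).val =
      Localization.mk (Ideal.Quotient.mk _ p)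
        (⟨Z.coordinate i ^ n, n, rfl⟩ : Submonoid.powers (Z.coordinate i)) := rfl

theorem exists_fraction_eq (Z : ProjSubscheme σ A) (i : σ)
    (z : Away (quotientGrading (homogeneousSubmodule σ A) Z.ideal) (Z.coordinate i)) :
    ∃ (n : ℕ) (p : MvPolynomial σ A) (hp : p.IsHomogeneous n), Z.fraction i p hp = z := by
  obtain ⟨n, a, ha, rfl⟩ := Away.mk_surjective _ (Z.coordinate_mem i) z
  obtain ⟨p, hp, rfl⟩ := id ha
  have hp' : p.IsHomogeneous n := by
    have h : p.IsHomogeneous (n • 1) := hp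
    rwa [smul_eq_mul, mul_one] at h
  exact ⟨n, p, hp', rfl⟩

theorem fraction_mul_pow (Z : ProjSubscheme σ A) (i : σ) {n : ℕ} (p : MvPolynomial σ A)
    (hp : p.IsHomogeneous n) (m : ℕ) :
    Z.fraction i (MvPolynomial.X i ^ m * p) ((MvPolynomial.isHomogeneous_X_pow i m).mul hp) =
      Z.fraction i p hp := by
  apply HomogeneousLocalization.val_injective
  rw [val_fraction, val_fraction, Localization.mk_eq_mk_iff, Localization.r_iff_exists]
  refine ⟨1, ?_⟩
  simp only [map_mul, map_pow, coordinate, pow_add]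
  ring

theorem fraction_eq_of_sub_mem (Z : ProjSubscheme σ A) (i : σ) {n : ℕ} {p q : MvPolynomial σ A}
    (hp : p.IsHomogeneous n) (hq : q.IsHomogeneous n) (h : p - q ∈ Z.ideal.toIdeal) :
    Z.fraction i p hp = Z.fraction i q hq := by
  apply HomogeneousLocalization.val_injective
  rw [val_fraction, val_fraction, Ideal.Quotient.eq.mpr h]

theorem map_fraction (φ : A →+* B) (Z : ProjSubscheme σ A) (i : σ) {n : ℕ} (p : MvPolynomial σ A)
    (hp : p.IsHomogeneous n) :
    Away.map (Z.baseChangeHom φ) (Z.coordinate i) (Z.fraction i p hp) =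
      Away.mk _ ((Z.baseChangeHom φ).map_mem (Z.coordinate_mem i)) n
        (Ideal.Quotient.mk _ (MvPolynomial.map φ p))
        (mk_mem_quotientGrading _ (by rw [smul_eq_mul, mul_one]; exact hp.map φ)) :=
  Away.map_mk _ _ _ _ _ _

theorem surjective_away_map_baseChangeHom (φ : A →+* B) (hφ : Function.Surjective φ)
    (Z : ProjSubscheme σ A) (i : σ) :
    Function.Surjective (Away.map (Z.baseChangeHom φ) (Z.coordinate i)) := by
  intro y
  obtain ⟨n, a, ha, rfl⟩ := Away.mk_surjective _
    ((Z.baseChangeHom φ).map_mem (Z.coordinate_mem i)) y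
  obtain ⟨q, hq, rfl⟩ := id ha
  have hq' : q.IsHomogeneous n := by
    have h : q.IsHomogeneous (n • 1) := hq
    rwa [smul_eq_mul, mul_one] at h
  obtain ⟨p, hp, rfl⟩ := exists_homogeneous_lift φ hφ hq'
  exact ⟨Z.fraction i p hp, map_fraction _ _ _ _ _⟩

/-- Expand `p` into monomials: each term is a scalar from `𝔞` times a fraction. -/
theorem fraction_mem_of_coeff_mem (Z : ProjSubscheme σ A) (i : σ) {n : ℕ} (p : MvPolynomial σ A)
    (hp : p.IsHomogeneous n) (𝔞 : Ideal A) (h : ∀ d, p.coeff d ∈ 𝔞) :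
    Z.fraction i p hp ∈ 𝔞.map (Z.chartAlgebraMap (Z.coordinate i)) := by
  classical
  have hmon (d : p.support) :
      (MvPolynomial.monomial (R := A) d.1 1).IsHomogeneous n :=
    MvPolynomial.isHomogeneous_monomial _ (by
      have := hp (MvPolynomial.mem_support_iff.mp d.2)
      rw [← this, Finsupp.degree_eq_weight_one]
      rfl)
  have key : Z.fraction i p hp = ∑ d : p.support,
      Z.chartAlgebraMap (Z.coordinate i) (p.coeff d.1) * Z.fraction i _ (hmon d) := by
    apply HomogeneousLocalization.val_injective
    rw [HomogeneousLocalization.val_sum]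
    simp only [HomogeneousLocalization.val_mul, val_chartAlgebraMap, val_fraction,
      Localization.mk_mul, one_mul, ← map_mul, MvPolynomial.C_mul_monomial, mul_one]
    rw [← Localization.mk_sum, ← map_sum, Finset.sum_coe_sort p.support
      (fun d => MvPolynomial.monomial d (p.coeff d)), ← p.as_sum]
  rw [key]
  exact Ideal.sum_mem _ fun d _ => Ideal.mul_mem_right _ _ (Ideal.mem_map_of_mem _ (h _))

/-- The kernel of the base change to a quotient of the base ring is generated, on each chart, by
the kernel of the homomorphism of base rings. -/
theorem ker_away_map_baseChangeHom_le (φ : A →+* B) (hφ : Function.Surjective φ)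
    (Z : ProjSubscheme σ A) (i : σ) :
    RingHom.ker (Away.map (Z.baseChangeHom φ) (Z.coordinate i)) ≤
      (RingHom.ker φ).map (Z.chartAlgebraMap (Z.coordinate i)) := by
  classical
  intro z hz
  obtain ⟨n, p, hp, rfl⟩ := Z.exists_fraction_eq i z
  rw [RingHom.mem_ker, map_fraction, away_mk_eq_zero_iff] at hz
  obtain ⟨m, hm⟩ := hz
  replace hm : (Z.baseChange φ).coordinate i ^ m *
      Ideal.Quotient.mk (Z.baseChange φ).ideal.toIdeal (MvPolynomial.map φ p) = 0 := by
    rw [← baseChangeHom_coordinate]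
    exact hm
  have hm' : MvPolynomial.X i ^ m * MvPolynomial.map φ p ∈ (Z.baseChange φ).ideal :=
    Ideal.Quotient.eq_zero_iff_mem.mp (by rw [map_mul, map_pow]; exact hm)
  obtain ⟨l, hl⟩ := hm' i
  obtain ⟨q, hq, hq'⟩ := (mem_ideal_map_iff_of_surjective φ hφ _ _).mp hl
  rw [← mul_assoc, ← pow_add] at hq'
  have hN := (MvPolynomial.isHomogeneous_X_pow (R := A) i (l + m)).mul hp
  have hN' := (MvPolynomial.isHomogeneous_X_pow (R := B) i (l + m)).mul (hp.map φ)
  -- The component of the right degree has the same image as `x_i ^ (l + m) * p`, so subtracting it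
  -- leaves the fraction unchanged and moves all coefficients into the kernel of `φ`.
  let q' : MvPolynomial σ A := DirectSum.decompose (homogeneousSubmodule σ A) q (l + m + n)
  have hq'N : q'.IsHomogeneous (l + m + n) :=
    (DirectSum.decompose (homogeneousSubmodule σ A) q (l + m + n)).2
  have hq'Z : q' ∈ Z.ideal.toIdeal := Z.ideal.isHomogeneous _ hq
  have hq'φ : MvPolynomial.map φ q' = MvPolynomial.X i ^ (l + m) * MvPolynomial.map φ p := by
    have h := (scalarExtension σ φ).map_directSumDecompose (x := q) (i := l + m + n)
    rw [scalarExtension_apply, scalarExtension_apply, hq'] at h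
    exact h.trans (DirectSum.decompose_of_mem_same _ hN')
  rw [← fraction_mul_pow Z i p hp (l + m), fraction_eq_of_sub_mem Z i hN (hN.sub hq'N)
    (by rwa [sub_sub_cancel])]
  refine fraction_mem_of_coeff_mem Z i _ _ _ fun d => ?_
  rw [RingHom.mem_ker, ← MvPolynomial.coeff_map, map_sub, hq'φ, map_mul, map_pow,
    MvPolynomial.map_X, sub_self, MvPolynomial.coeff_zero]

/-- Here $S'=S/\ker\beta$ with $\ker\beta$ generated by the image of $\ker\varphi$, which is
$S\otimes_R R/\ker\varphi$. A map out of the pushout is determined by its restriction to $S$. -/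
theorem _root_.CommRingCat.isPushout_of_surjective {R S R' S' : Type u} [CommRing R] [CommRing S]
    [CommRing R'] [CommRing S'] (α : R →+* S) (φ : R →+* R') (β : S →+* S') (γ : R' →+* S')
    (hw : β.comp α = γ.comp φ) (hφ : Function.Surjective φ) (hβ : Function.Surjective β)
    (hker : RingHom.ker β ≤ (RingHom.ker φ).map α) :
    IsPushout (CommRingCat.ofHom α) (CommRingCat.ofHom φ) (CommRingCat.ofHom β)
      (CommRingCat.ofHom γ) := by
  refine ⟨⟨by rw [← CommRingCat.ofHom_comp, ← CommRingCat.ofHom_comp, hw]⟩, ⟨?_⟩⟩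
  refine Limits.PushoutCocone.isColimitAux' _ fun s => ?_
  have hs : s.inl.hom.comp α = s.inr.hom.comp φ := congrArg CommRingCat.Hom.hom s.condition
  have hker' : RingHom.ker β ≤ RingHom.ker s.inl.hom := by
    refine hker.trans (Ideal.map_le_iff_le_comap.mpr fun a ha => ?_)
    change s.inl.hom.comp α a = 0
    rw [hs, RingHom.comp_apply, (RingHom.mem_ker).mp ha, map_zero]
  let d := RingHom.liftOfSurjective β hβ ⟨s.inl.hom, hker'⟩
  have hd : d.comp β = s.inl.hom := RingHom.liftOfRightInverse_comp _ _ _ _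
  refine ⟨CommRingCat.ofHom d, ?_, ?_, ?_⟩
  · ext z
    exact RingHom.congr_fun hd z
  · ext b
    obtain ⟨a, rfl⟩ := hφ b
    have h1 := RingHom.congr_fun hw a
    have h2 := RingHom.congr_fun hs a
    simp only [RingHom.comp_apply] at h1 h2
    change d (γ (φ a)) = s.inr.hom (φ a)
    rw [← h1, ← h2]
    exact RingHom.congr_fun hd _
  · intro e he _
    ext z
    obtain ⟨y, rfl⟩ := hβ z
    exact (RingHom.congr_fun (congrArg CommRingCat.Hom.hom he) y).trans
      (RingHom.congr_fun hd y).symm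

theorem away_map_comp_chartAlgebraMap (φ : A →+* B) (Z : ProjSubscheme σ A) (i : σ) :
    (Away.map (Z.baseChangeHom φ) (Z.coordinate i)).comp (Z.chartAlgebraMap (Z.coordinate i)) =
      ((Z.baseChange φ).chartAlgebraMap (Z.baseChangeHom φ (Z.coordinate i))).comp φ := by
  ext a
  have h : Z.chartAlgebraMap (Z.coordinate i) a =
      Z.fraction i (MvPolynomial.C a) (MvPolynomial.isHomogeneous_C σ a) := by
    apply HomogeneousLocalization.val_injective
    rw [val_chartAlgebraMap, val_fraction, Localization.mk_eq_mk_iff, Localization.r_iff_exists]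
    exact ⟨1, by simp⟩
  rw [RingHom.comp_apply, RingHom.comp_apply, h, map_fraction]
  rw [val_chartAlgebraMap, Away.val_mk, Localization.mk_eq_mk_iff, Localization.r_iff_exists]
  exact ⟨1, by simp⟩

/-- The preimages of the covering sets enter as arbitrary cartesian squares, so that explicit affine
charts can be used for them. -/
theorem _root_.AlgebraicGeometry.Scheme.isPullback_of_openCover_of_isPullback {X Y S W : Scheme.{u}}
    (p : W ⟶ X) (r : W ⟶ Y) (f : X ⟶ S) (g : Y ⟶ S) (𝒰 : X.OpenCover) (V : 𝒰.I₀ → Scheme.{u})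
    (b : ∀ i, V i ⟶ 𝒰.X i) (a : ∀ i, V i ⟶ W) (h : ∀ i, IsPullback (b i) (a i) (𝒰.f i) p)
    (h' : ∀ i, IsPullback (b i) (a i ≫ r) (𝒰.f i ≫ f) g) : IsPullback p r f g := by
  refine Scheme.isPullback_of_openCover _ _ _ _ 𝒰 fun i => ?_
  refine IsPullback.of_iso (h' i) (h i).flip.isoPullback (Iso.refl _) (Iso.refl _) (Iso.refl _)
    ?_ ?_ ?_ ?_
  · rw [Iso.refl_hom, Category.comp_id]
    exact ((h i).flip.isoPullback_hom_snd).symm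
  · rw [Iso.refl_hom, Category.comp_id]
    exact ((h i).flip.isoPullback_hom_fst_assoc r).symm
  · simp
  · simp

/-- The base change defined through saturated ideals is the scheme-theoretic one. It is checked on
the standard charts, where both the map and the kernel are explicit. -/
theorem isPullback_baseChangeMap (φ : A →+* B) (hφ : Function.Surjective φ)
    (Z : ProjSubscheme σ A) :
    IsPullback (Z.baseChangeMap φ) (Z.baseChange φ).toBase Z.toBase
      (Spec.map (CommRingCat.ofHom φ)) := by
  refine Scheme.isPullback_of_openCover_of_isPullback _ _ _ _ Z.charts.openCover _ _ _
    (fun i => isPullback_chart φ Z i) fun i => ?_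
  have h := isPullback_SpecMap_of_isPushout _ _ _ _ (CommRingCat.isPushout_of_surjective _ _ _ _
    (away_map_comp_chartAlgebraMap φ Z i) hφ (surjective_away_map_baseChangeHom φ hφ Z i)
    (ker_away_map_baseChangeHom_le φ hφ Z i))
  rw [← awayι_toBase Z (Z.coordinate_mem i) one_pos, ← awayι_toBase (Z.baseChange φ)
    ((Z.baseChangeHom φ).map_mem (Z.coordinate_mem i)) one_pos] at h
  exact h

/-- The fibres of isomorphic families are isomorphic. -/
theorem nonempty_iso_baseChange (φ : A →+* B) (hφ : Function.Surjective φ)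
    {Z : ProjSubscheme σ A} {Z' : ProjSubscheme τ A} (h : Z.IsoOverBase Z') :
    Nonempty ((Z.baseChange φ).toScheme ≅ (Z'.baseChange φ).toScheme) := by
  obtain ⟨e, he⟩ := h
  have h1 := isPullback_baseChangeMap φ hφ Z
  have h2 := isPullback_baseChangeMap φ hφ Z'
  have h3 : IsPullback (Z.baseChangeMap φ ≫ e.hom) (Z.baseChange φ).toBase Z'.toBase
      (Spec.map (CommRingCat.ofHom φ)) :=
    IsPullback.of_iso h1 (Iso.refl _) e (Iso.refl _) (Iso.refl _) (by simp) (by simp) (by simp [he])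
      (by simp)
  exact ⟨h3.isoIsPullback _ _ h2⟩

theorem isVariety_of_iso {k : Type u} [Field k] {Z : ProjSubscheme σ k} {Z' : ProjSubscheme τ k}
    (hZ : Z.IsVariety) (e : Z.toScheme ≅ Z'.toScheme) : Z'.IsVariety :=
  have : IsIntegral Z.toScheme := hZ
  IsIntegral.of_isIso e.hom

/-! ## Isomorphisms given by isomorphisms of coordinate rings -/

section

variable {R S ρ ς : Type u} [CommRing R] [SetLike ρ R] [AddSubgroupClass ρ R]
  [CommRing S] [SetLike ς S] [AddSubgroupClass ς S]
  {𝒜 : ℕ → ρ} {ℬ : ℕ → ς} [GradedRing 𝒜] [GradedRing ℬ]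

/-- The inverse of a bijective homomorphism of graded rings. -/
def _root_.GradedRingHom.inverse (f : GradedRingHom 𝒜 ℬ) (hf : Function.Bijective f) :
    GradedRingHom ℬ 𝒜 where
  toRingHom := ((RingEquiv.ofBijective f.toRingHom hf).symm : S →+* R)
  map_mem := by
    intro n y hy
    obtain ⟨x, rfl⟩ := hf.2 y
    have h := f.map_directSumDecompose (x := x) (i := n)
    rw [DirectSum.decompose_of_mem_same _ hy] at h
    have hx : ((RingEquiv.ofBijective f.toRingHom hf).symm : S →+* R) (f x) = x :=
      (RingEquiv.ofBijective f.toRingHom hf).symm_apply_apply x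
    rw [hx, ← hf.1 h]
    exact (DirectSum.decompose 𝒜 x n).2

theorem _root_.GradedRingHom.inverse_comp (f : GradedRingHom 𝒜 ℬ) (hf : Function.Bijective f) :
    (f.inverse hf).comp f = GradedRingHom.id 𝒜 :=
  DFunLike.ext _ _ (RingEquiv.ofBijective f.toRingHom hf).symm_apply_apply

theorem _root_.GradedRingHom.comp_inverse (f : GradedRingHom 𝒜 ℬ) (hf : Function.Bijective f) :
    f.comp (f.inverse hf) = GradedRingHom.id ℬ :=
  DFunLike.ext _ _ (RingEquiv.ofBijective f.toRingHom hf).apply_symm_apply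

theorem _root_.GradedRingHom.irrelevant_le_map (f : GradedRingHom 𝒜 ℬ)
    (hf : Function.Surjective f) :
    HomogeneousIdeal.irrelevant ℬ ≤ (HomogeneousIdeal.irrelevant 𝒜).map f := by
  rw [HomogeneousIdeal.irrelevant_le]
  intro n hn y hy
  obtain ⟨x, rfl⟩ := hf y
  have h := f.map_directSumDecompose (x := x) (i := n)
  have hy' : f x ∈ ℬ n := hy
  rw [DirectSum.decompose_of_mem_same _ hy'] at h
  change f x ∈ Ideal.map f _
  rw [← h]
  exact Ideal.mem_map_of_mem _
    (HomogeneousIdeal.mem_irrelevant_of_mem _ hn (DirectSum.decompose 𝒜 x n).2)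

theorem _root_.GradedRingHom.isIso_projMap (f : GradedRingHom 𝒜 ℬ) (hf : Function.Bijective f) :
    IsIso (Proj.map f (f.irrelevant_le_map hf.2)) := by
  have hs : Function.Surjective (f.inverse hf) :=
    (RingEquiv.ofBijective f.toRingHom hf).symm.surjective
  refine ⟨Proj.map (f.inverse hf) ((f.inverse hf).irrelevant_le_map hs), ?_, ?_⟩
  · rw [← Proj.map_comp, ← Proj.map_id]
    simp only [f.comp_inverse hf]
  · rw [← Proj.map_comp, ← Proj.map_id]
    simp only [f.inverse_comp hf]

end

/-- A surjective graded homomorphism of polynomial algebras over the base induces an isomorphism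
from a closed subscheme to the one defined by the preimage of its ideal. -/
theorem isoOverBase_of_surjective (g : MvPolynomial τ A →ₐ[A] MvPolynomial σ A)
    (hg : IsFormsMap g 1) (hsurj : Function.Surjective g) {Z : ProjSubscheme σ A}
    {Z' : ProjSubscheme τ A} (h : Z'.ideal.toIdeal = Z.ideal.toIdeal.comap g) :
    Z.IsoOverBase Z' := by
  let g' : GradedRingHom (homogeneousSubmodule τ A) (homogeneousSubmodule σ A) :=
    { g.toRingHom with
      map_mem := fun hx => by simpa using hg.isHomogeneous hx }
  have hle : Z'.ideal ≤ Z.ideal.comap g' := fun p hp => h.le hp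
  let f := coordinateRingHom g' _ _ hle
  have hf : Function.Bijective f := by
    constructor
    · rw [injective_iff_map_eq_zero]
      intro x hx
      obtain ⟨p, rfl⟩ := Ideal.Quotient.mk_surjective x
      have hx' : Ideal.Quotient.mk Z.ideal.toIdeal (g p) = 0 := hx
      exact Ideal.Quotient.eq_zero_iff_mem.mpr
        (h.ge (Ideal.mem_comap.mpr (Ideal.Quotient.eq_zero_iff_mem.mp hx')))
    · intro y
      obtain ⟨p, rfl⟩ := Ideal.Quotient.mk_surjective y
      obtain ⟨q, rfl⟩ := hsurj p
      exact ⟨Ideal.Quotient.mk _ q, rfl⟩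
  have hiso := f.isIso_projMap hf
  let e : Z.toScheme ⟶ Z'.toScheme := Proj.map f (f.irrelevant_le_map hf.2)
  have he : IsIso e := hiso
  refine ⟨asIso e, ?_⟩
  -- Compatibility with the structure morphisms is checked on charts, where it says that `f` fixes
  -- the constants.
  have key {n : ℕ} (hn : 0 < n) (x : MvPolynomial τ A ⧸ Z'.ideal.toIdeal)
      (hx : x ∈ quotientGrading (homogeneousSubmodule τ A) Z'.ideal n) :
      Proj.awayι _ (f x) (f.map_mem hx) hn ≫ Proj.map f (f.irrelevant_le_map hf.2) ≫ Z'.toBase =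
        Proj.awayι _ (f x) (f.map_mem hx) hn ≫ Z.toBase := by
    have h1 := awayι_toBase Z (f.map_mem hx) hn
    refine Eq.trans ?_ h1.symm
    have h2 := Proj.awayι_comp_map f (f.irrelevant_le_map hf.2) hn x hx
    refine (Category.assoc _ _ _).symm.trans ?_
    refine (congrArg (fun j => j ≫ Z'.toBase) h2).trans ?_
    refine (Category.assoc _ _ _).trans ?_
    refine (congrArg (fun j => _ ≫ j) (awayι_toBase Z' hx hn)).trans ?_
    rw [← Spec.map_comp, ← CommRingCat.ofHom_comp]
    congr 2
    ext a
    have hval : (Away.map f x (Z'.chartAlgebraMap x a)).val =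
        Localization.mk (f (Ideal.Quotient.mk _ (MvPolynomial.C a)))
          (⟨f 1, 0, by simp⟩ : Submonoid.powers (f x)) := rfl
    have hC : f (Ideal.Quotient.mk _ (MvPolynomial.C a)) =
        Ideal.Quotient.mk _ (MvPolynomial.C a) :=
      congrArg (Ideal.Quotient.mk Z.ideal.toIdeal) (g.commutes a)
    refine hval.trans ?_
    rw [val_chartAlgebraMap, Localization.mk_eq_mk_iff, Localization.r_iff_exists, hC]
    exact ⟨1, by simp⟩
  exact (Proj.mapAffineOpenCover f (f.irrelevant_le_map hf.2)).openCover.hom_ext _ _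
    fun s => key s.1.2 _ s.2.2

end ProjSubscheme

/-! ## Hilbert functions -/

section Hilbert

variable {σ : Type} {A : Type u} [CommRing A]

/-- The Hilbert function of a homogeneous ideal. -/
def hilbertFunction (I : HomogeneousIdeal (homogeneousSubmodule σ A)) (d : ℕ) : ℕ :=
  Module.finrank A (quotientGrading (homogeneousSubmodule σ A) I d)

instance finite_quotientGrading [Finite σ] (I : HomogeneousIdeal (homogeneousSubmodule σ A))
    (d : ℕ) : Module.Finite A (quotientGrading (homogeneousSubmodule σ A) I d) :=
  Module.Finite.iff_fg.mpr ((MvPolynomial.homogeneousSubmodule_fg σ A d).map _)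

theorem mem_quotientGrading_iff {I : HomogeneousIdeal (homogeneousSubmodule σ A)} {d : ℕ}
    {x : MvPolynomial σ A ⧸ I.toIdeal} :
    x ∈ quotientGrading (homogeneousSubmodule σ A) I d ↔
      ∃ p : MvPolynomial σ A, p.IsHomogeneous d ∧ Ideal.Quotient.mk I.toIdeal p = x :=
  Iff.rfl

theorem mk_C_mul (I : HomogeneousIdeal (homogeneousSubmodule σ A)) (a : A) (p : MvPolynomial σ A) :
    Ideal.Quotient.mk I.toIdeal (MvPolynomial.C a * p) = a • Ideal.Quotient.mk I.toIdeal p := by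
  rw [← MvPolynomial.smul_eq_C_mul]
  rfl

/-- All ideals of interest are kernels of parametrizations; their Hilbert functions can then be
computed as dimensions of spaces of forms in the target. -/
theorem hilbertFunction_eq_finrank_map {V : Type*} [AddCommGroup V] [Module A V]
    (I : HomogeneousIdeal (homogeneousSubmodule σ A)) (L : MvPolynomial σ A →ₗ[A] V)
    (hL : ∀ p, L p = 0 ↔ p ∈ I) (d : ℕ) :
    hilbertFunction I d = Module.finrank A ((homogeneousSubmodule σ A d).map L) := by
  let Q := (Ideal.Quotient.mkₐ A I.toIdeal).toLinearMap
  have hker : LinearMap.ker Q = LinearMap.ker L := by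
    ext p
    rw [LinearMap.mem_ker, LinearMap.mem_ker, hL]
    exact Ideal.Quotient.eq_zero_iff_mem
  have hQ : Function.Surjective Q := Ideal.Quotient.mk_surjective
  let e := (Q.quotKerEquivOfSurjective hQ).symm.trans (Submodule.quotEquivOfEq _ _ hker)
  let L' : (MvPolynomial σ A ⧸ I.toIdeal) →ₗ[A] V :=
    ((LinearMap.ker L).liftQ L le_rfl).comp e.toLinearMap
  have hL' (p : MvPolynomial σ A) : L' (Q p) = L p := by
    have : (Q.quotKerEquivOfSurjective hQ).symm (Q p) = Submodule.Quotient.mk p :=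
      (LinearEquiv.symm_apply_eq _).mpr rfl
    simp only [L', e, LinearMap.comp_apply, LinearEquiv.coe_coe, LinearEquiv.trans_apply, this]
    rfl
  have hinj : Function.Injective L' := by
    rw [injective_iff_map_eq_zero]
    intro x hx
    obtain ⟨p, rfl⟩ := hQ x
    rw [hL', hL] at hx
    exact Ideal.Quotient.eq_zero_iff_mem.mpr hx
  have h := (Submodule.equivMapOfInjective L' hinj
    (quotientGrading (homogeneousSubmodule σ A) I d)).finrank_eq
  rw [hilbertFunction, h, quotientGrading, ← Submodule.map_comp]
  have hcomp : L' ∘ₗ Q = L := LinearMap.ext hL'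
  rw [hcomp]

/-- The exponents of a monomial of degree `d` are at most `d`. Any polynomial bound is good enough
for the growth argument. -/
theorem hilbertFunction_le_pow {k : Type u} [Field k] [Fintype σ]
    (I : HomogeneousIdeal (homogeneousSubmodule σ k)) (d : ℕ) :
    hilbertFunction I d ≤ (d + 1) ^ Fintype.card σ := by
  classical
  let b : (σ → Fin (d + 1)) → MvPolynomial σ k ⧸ I.toIdeal := fun e =>
    Ideal.Quotient.mk _ (MvPolynomial.monomial
      (Finsupp.equivFunOnFinite.symm fun i => (e i : ℕ)) 1)
  have hle : quotientGrading (homogeneousSubmodule σ k) I d ≤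
      Submodule.span k (Set.range b) := by
    rintro _ ⟨p, hp, rfl⟩
    change Ideal.Quotient.mk I.toIdeal p ∈ _
    rw [p.as_sum, map_sum]
    refine Submodule.sum_mem _ fun e he => ?_
    have hdeg : e.degree = d := by
      have := hp (MvPolynomial.mem_support_iff.mp he)
      rw [← this, Finsupp.degree_eq_weight_one]
      rfl
    rw [← mul_one (p.coeff e), ← MvPolynomial.C_mul_monomial, mk_C_mul]
    refine Submodule.smul_mem _ _ (Submodule.subset_span ⟨fun i => ⟨e i, ?_⟩, ?_⟩)
    · exact Nat.lt_succ_of_le (hdeg ▸ Finsupp.le_degree i e)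
    · have : Finsupp.equivFunOnFinite.symm (fun i => e i) = e := by
        ext i
        rfl
      simp only [b, this]
  have := FiniteDimensional.span_of_finite k (Set.finite_range b)
  refine (Submodule.finrank_mono hle).trans ((finrank_range_le_card b).trans ?_)
  simp

/-! ### Hilbert functions of the fibres of a family -/

/-- The Hilbert function does not depend on the fibre in a family over the affine line without
torsion. -/
theorem hilbertFunction_map_evalRingHom {k : Type u} [Field k] [Finite σ]
    (I : HomogeneousIdeal (homogeneousSubmodule σ k[X]))
    (hI : ∀ (a : k[X]) (p : MvPolynomial σ k[X]), a ≠ 0 → MvPolynomial.C a * p ∈ I → p ∈ I)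
    (a : k) (d : ℕ) :
    hilbertFunction (I.map (ProjSubscheme.scalarExtension σ (Polynomial.evalRingHom a))) d =
      hilbertFunction I d := by
  classical
  have hsurj : Function.Surjective (Polynomial.evalRingHom a) :=
    fun c => ⟨Polynomial.C c, by simp⟩
  -- A finitely generated torsion-free module over the principal ideal domain `k[X]` is free; a
  -- basis of it specializes to a basis of the fibre.
  have htf : Module.IsTorsionFree k[X] (quotientGrading (homogeneousSubmodule σ k[X]) I d) := by
    refine Module.IsTorsionFree.of_smul_eq_zero fun r m hm => ?_
    by_contra! h
    obtain ⟨p, hp, hpm⟩ := mem_quotientGrading_iff.mp m.2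
    refine h.2 (Subtype.ext ?_)
    have hm' : r • (m : MvPolynomial σ k[X] ⧸ I.toIdeal) = 0 := congrArg Subtype.val hm
    rw [← hpm, ← mk_C_mul, Ideal.Quotient.eq_zero_iff_mem] at hm'
    rw [← hpm]
    exact Ideal.Quotient.eq_zero_iff_mem.mpr (hI r p h.1 hm')
  let ev : MvPolynomial σ k[X] →+* MvPolynomial σ k :=
    MvPolynomial.map (Polynomial.evalRingHom a)
  let Ia := I.map (ProjSubscheme.scalarExtension σ (Polynomial.evalRingHom a))
  have hIa (q : MvPolynomial σ k) : q ∈ Ia ↔ ∃ p ∈ I, ev p = q :=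
    ProjSubscheme.mem_ideal_map_iff_of_surjective _ hsurj I q
  let b := Module.finBasis k[X] (quotientGrading (homogeneousSubmodule σ k[X]) I d)
  choose B hB hBb using fun i => mem_quotientGrading_iff.mp (b i).2
  have hcomb (h : Fin (Module.finrank k[X] (quotientGrading (homogeneousSubmodule σ k[X]) I d)) →
      k[X]) : Ideal.Quotient.mk I.toIdeal (∑ i, MvPolynomial.C (h i) * B i) =
        ((∑ i, h i • b i : quotientGrading (homogeneousSubmodule σ k[X]) I d) :
          MvPolynomial σ k[X] ⧸ I.toIdeal) := by
    rw [map_sum, AddSubmonoidClass.coe_finsetSum]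
    exact Finset.sum_congr rfl fun i _ => by rw [mk_C_mul, hBb]; rfl
  have hexp (p : MvPolynomial σ k[X]) (hp : p.IsHomogeneous d) :
      ∃ h : Fin _ → k[X], p - ∑ i, MvPolynomial.C (h i) * B i ∈ I.toIdeal ∧
        ∑ i, h i • b i = ⟨Ideal.Quotient.mk I.toIdeal p, p, hp, rfl⟩ := by
    refine ⟨b.repr ⟨Ideal.Quotient.mk I.toIdeal p, p, hp, rfl⟩, ?_, b.sum_repr _⟩
    rw [← Ideal.Quotient.eq, hcomb, b.sum_repr]
  let v : Fin (Module.finrank k[X] (quotientGrading (homogeneousSubmodule σ k[X]) I d)) →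
      MvPolynomial σ k ⧸ Ia.toIdeal := fun i => Ideal.Quotient.mk _ (ev (B i))
  have hv (c : Fin _ → k) : ∑ i, c i • v i =
      Ideal.Quotient.mk Ia.toIdeal (∑ i, MvPolynomial.C (c i) * ev (B i)) := by
    rw [map_sum]
    exact Finset.sum_congr rfl fun i _ => by rw [mk_C_mul]
  have hli : LinearIndependent k v := by
    rw [Fintype.linearIndependent_iff]
    intro c hc
    rw [hv, Ideal.Quotient.eq_zero_iff_mem] at hc
    obtain ⟨G, hG, hGc⟩ := (hIa _).mp hc
    let P : MvPolynomial σ k[X] := ∑ i, MvPolynomial.C (Polynomial.C (c i)) * B i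
    have hP : P.IsHomogeneous d := MvPolynomial.IsHomogeneous.sum _ _ _ fun i _ => by
      simpa using (MvPolynomial.isHomogeneous_C σ (Polynomial.C (c i))).mul (hB i)
    have hevP : ev P = ev G := by
      rw [hGc]
      simp [P, ev]
    -- A relation at `a` lifts to `P`, which agrees at `a` with some `G` in `I`; hence `P - G` is
    -- divisible by `t - a`.
    obtain ⟨H, hH⟩ : MvPolynomial.C (Polynomial.X - Polynomial.C a) ∣ P - G := by
      rw [MvPolynomial.C_dvd_iff_dvd_coeff]
      intro e
      rw [Polynomial.dvd_iff_isRoot, Polynomial.IsRoot.def, ← Polynomial.coe_evalRingHom,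
        ← MvPolynomial.coeff_map, map_sub]
      change MvPolynomial.coeff e (ev P - ev G) = 0
      rw [hevP, sub_self, MvPolynomial.coeff_zero]
    have hX0 : (MvPolynomial.C (Polynomial.X - Polynomial.C a) : MvPolynomial σ k[X]) ∈
        homogeneousSubmodule σ k[X] 0 := MvPolynomial.isHomogeneous_C _ _
    let G' : MvPolynomial σ k[X] := DirectSum.decompose (homogeneousSubmodule σ k[X]) G d
    let H' : MvPolynomial σ k[X] := DirectSum.decompose (homogeneousSubmodule σ k[X]) H d
    have hH'd : H'.IsHomogeneous d := (DirectSum.decompose (homogeneousSubmodule σ k[X]) H d).2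
    have hG' : G' ∈ I.toIdeal := I.isHomogeneous d hG
    have hH' : P - G' = MvPolynomial.C (Polynomial.X - Polynomial.C a) * H' := by
      have h : P - G' = DirectSum.decompose (homogeneousSubmodule σ k[X]) (P - G) d := by
        rw [DirectSum.decompose_sub]
        exact congrArg (fun F => F - G') (DirectSum.decompose_of_mem_same _ hP).symm
      rw [h, hH]
      have h' := DirectSum.coe_decompose_mul_add_of_left_mem
        (homogeneousSubmodule σ k[X]) (j := d) (b := H) hX0
      rwa [zero_add] at h'
    obtain ⟨h, -, hh⟩ := hexp H' hH'd
    -- The cofactor is expanded in the basis `b`; comparing coordinates, each constant `c i` is a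
    -- multiple of `t - a` and so zero.
    have hsum : ∑ i, (Polynomial.C (c i)) • b i =
        ∑ i, ((Polynomial.X - Polynomial.C a) * h i) • b i := by
      simp only [mul_smul, ← Finset.smul_sum]
      rw [hh]
      apply Subtype.ext
      rw [← hcomb]
      change Ideal.Quotient.mk I.toIdeal P =
        (Polynomial.X - Polynomial.C a) • Ideal.Quotient.mk I.toIdeal H'
      rw [← mk_C_mul, ← hH', Ideal.Quotient.eq]
      rwa [sub_sub_cancel]
    intro i
    have := Fintype.linearIndependent_iff.mp b.linearIndependent
      (fun i => Polynomial.C (c i) - (Polynomial.X - Polynomial.C a) * h i)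
      (by simp only [sub_smul, Finset.sum_sub_distrib, hsum, sub_self]) i
    simpa using congrArg (Polynomial.eval a) this
  have hspan : Submodule.span k (Set.range v) =
      quotientGrading (homogeneousSubmodule σ k) Ia d := by
    apply le_antisymm
    · rw [Submodule.span_le]
      rintro _ ⟨i, rfl⟩
      exact ProjSubscheme.mk_mem_quotientGrading _ ((hB i).map _)
    · rintro _ ⟨q, hq, rfl⟩
      obtain ⟨p, hp, rfl⟩ := ProjSubscheme.exists_homogeneous_lift _ hsurj hq
      obtain ⟨h, hh, -⟩ := hexp p hp
      have hmem : ev (p - ∑ i, MvPolynomial.C (h i) * B i) ∈ Ia.toIdeal :=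
        (hIa _).mpr ⟨_, hh, rfl⟩
      rw [map_sub, ← Ideal.Quotient.eq] at hmem
      change Ideal.Quotient.mk Ia.toIdeal (ev p) ∈ _
      rw [hmem, map_sum]
      have : ∑ i, ev (MvPolynomial.C (h i) * B i) =
          ∑ i, MvPolynomial.C ((h i).eval a) * ev (B i) :=
        Finset.sum_congr rfl fun i _ => by simp [ev]
      rw [this, ← hv]
      exact Submodule.sum_mem _ fun i _ =>
        Submodule.smul_mem _ _ (Submodule.subset_span ⟨i, rfl⟩)
  change Module.finrank k (quotientGrading (homogeneousSubmodule σ k) Ia d) = _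
  rw [← hspan, finrank_span_eq_card hli, Fintype.card_fin]
  rfl

/-! ### Saturation -/

/-- The saturation is finitely generated, so the exponents for its generators and for the finitely
many variables have a common bound. -/
theorem exists_forall_pow_mul_mem {A : Type u} [CommRing A] [IsNoetherianRing A] [Finite σ]
    (I : HomogeneousIdeal (homogeneousSubmodule σ A)) :
    ∃ n : ℕ, ∀ i, ∀ f ∈ (ProjSubscheme.zeroScheme I).ideal, MvPolynomial.X i ^ n * f ∈ I := by
  classical
  have := Fintype.ofFinite σ
  obtain ⟨T, hT⟩ := IsNoetherian.noetherian (ProjSubscheme.zeroScheme I).ideal.toIdeal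
  have hTmem (g : T) : (g : MvPolynomial σ A) ∈ (ProjSubscheme.zeroScheme I).ideal :=
    hT.le (Submodule.subset_span g.2)
  choose N hN using fun (g : T) (i : σ) => hTmem g i
  let n := Finset.univ.sup fun g => Finset.univ.sup (N g)
  refine ⟨n, fun i f hf => ?_⟩
  have hle : Submodule.span (MvPolynomial σ A) (T : Set (MvPolynomial σ A)) ≤
      Submodule.comap (LinearMap.mulLeft (MvPolynomial σ A) (MvPolynomial.X i ^ n))
        I.toIdeal := by
    rw [Submodule.span_le]
    intro g hg
    have hle : N ⟨g, hg⟩ i ≤ n :=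
      (Finset.le_sup (f := N ⟨g, hg⟩) (Finset.mem_univ i)).trans
        (Finset.le_sup (f := fun g => Finset.univ.sup (N g)) (Finset.mem_univ _))
    change MvPolynomial.X i ^ n * g ∈ I.toIdeal
    rw [← Nat.sub_add_cancel hle, pow_add, mul_assoc]
    exact I.toIdeal.mul_mem_left _ (hN ⟨g, hg⟩ i)
  exact hle (hT.ge hf)

/-- By the pigeonhole principle, a monomial of such large degree is divisible by the `n`-th power of
a variable. -/
theorem monomial_mul_mem {A : Type u} [CommRing A] [Fintype σ]
    (I : HomogeneousIdeal (homogeneousSubmodule σ A)) {n : ℕ} {f : MvPolynomial σ A}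
    (hf : ∀ i, MvPolynomial.X i ^ n * f ∈ I) {e : σ →₀ ℕ} (he : Fintype.card σ * n < e.degree)
    (c : A) : MvPolynomial.monomial e c * f ∈ I := by
  obtain ⟨i, hi⟩ : ∃ i, n ≤ e i := by
    by_contra! h
    refine he.not_ge ?_
    rw [Finsupp.degree_eq_sum]
    exact (Finset.sum_le_card_nsmul _ _ n fun i _ => (h i).le).trans (by simp)
  have : MvPolynomial.monomial e c =
      MvPolynomial.monomial (e - Finsupp.single i n) c * MvPolynomial.X i ^ n := by
    rw [MvPolynomial.X_pow_eq_monomial, MvPolynomial.monomial_mul, mul_one, tsub_add_cancel_of_le]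
    rwa [Finsupp.single_le_iff]
  rw [this, mul_assoc]
  exact I.toIdeal.mul_mem_left _ (hf i)

/-- A homogeneous ideal agrees with its saturation in all large degrees. -/
theorem exists_forall_mem_of_mem_zeroScheme_ideal {A : Type u} [CommRing A] [IsNoetherianRing A]
    [Finite σ] (I : HomogeneousIdeal (homogeneousSubmodule σ A)) :
    ∃ d₀ : ℕ, ∀ d ≥ d₀, ∀ f ∈ (ProjSubscheme.zeroScheme I).ideal, f.IsHomogeneous d → f ∈ I := by
  classical
  have := Fintype.ofFinite σ
  obtain ⟨n, hn⟩ := exists_forall_pow_mul_mem I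
  obtain ⟨T, hT⟩ := IsNoetherian.noetherian (ProjSubscheme.zeroScheme I).ideal.toIdeal
  let D := T.sup MvPolynomial.totalDegree
  -- `D` bounds the degrees of the generators `g`. In degree `d`, a monomial coefficient of `g` that
  -- contributes has degree at least `d - D > card σ * n`, enough for `monomial_mul_mem`.
  refine ⟨Fintype.card σ * n + D + 1, fun d hd f hf hfd => ?_⟩
  obtain ⟨c, -, hc⟩ := Submodule.mem_span_finset.mp (hT.ge hf)
  rw [← DirectSum.decompose_of_mem_same (homogeneousSubmodule σ A) hfd, ← hc,
    DirectSum.decompose_sum, DFinsupp.finsetSum_apply, AddSubmonoidClass.coe_finsetSum]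
  refine sum_mem fun g hg => ?_
  have hgmem : g ∈ (ProjSubscheme.zeroScheme I).ideal := hT.le (Submodule.subset_span hg)
  rw [smul_eq_mul, (c g).as_sum, Finset.sum_mul, DirectSum.decompose_sum, DFinsupp.finsetSum_apply,
    AddSubmonoidClass.coe_finsetSum]
  refine sum_mem fun e _ => ?_
  have hmon : MvPolynomial.monomial e ((c g).coeff e) ∈ homogeneousSubmodule σ A e.degree :=
    MvPolynomial.isHomogeneous_monomial _ rfl
  by_cases hed : e.degree ≤ d
  · rw [DirectSum.coe_decompose_mul_of_left_mem_of_le _ hmon hed]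
    by_cases heD : D < d - e.degree
    · have h0 : (DirectSum.decompose (homogeneousSubmodule σ A) g (d - e.degree) :
          MvPolynomial σ A) = 0 :=
        (MvPolynomial.decomposition.decompose'_apply g _).trans
          (MvPolynomial.homogeneousComponent_eq_zero _ _
            ((Finset.le_sup (f := MvPolynomial.totalDegree) hg).trans_lt heD))
      rw [h0, mul_zero]
      exact zero_mem _
    · exact monomial_mul_mem I (fun i => hn i _
        ((ProjSubscheme.zeroScheme I).ideal.isHomogeneous _ hgmem)) (by omega) _
  · rw [DirectSum.coe_decompose_mul_of_left_mem_of_not_le _ hmon hed]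
    exact zero_mem _

theorem exists_hilbertFunction_zeroScheme_eq {A : Type u} [CommRing A] [IsNoetherianRing A]
    [Finite σ] (I : HomogeneousIdeal (homogeneousSubmodule σ A)) :
    ∃ d₀ : ℕ, ∀ d ≥ d₀,
      hilbertFunction (ProjSubscheme.zeroScheme I).ideal d = hilbertFunction I d := by
  obtain ⟨d₀, h⟩ := exists_forall_mem_of_mem_zeroScheme_ideal I
  refine ⟨d₀, fun d hd => ?_⟩
  let L : quotientGrading (homogeneousSubmodule σ A) I d →ₗ[A]
      quotientGrading (homogeneousSubmodule σ A) (ProjSubscheme.zeroScheme I).ideal d :=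
    (Ideal.Quotient.factorₐ A (ProjSubscheme.le_zeroScheme_ideal I :
      I.toIdeal ≤ (ProjSubscheme.zeroScheme I).ideal.toIdeal)).toLinearMap.restrict (by
        rintro _ ⟨p, hp, rfl⟩
        exact ⟨p, hp, rfl⟩)
  have hL : Function.Bijective L := by
    constructor
    · rw [injective_iff_map_eq_zero]
      rintro ⟨_, p, hp, rfl⟩ hx
      have hx' : Ideal.Quotient.mk (ProjSubscheme.zeroScheme I).ideal.toIdeal p = 0 :=
        congrArg Subtype.val hx
      exact Subtype.ext (Ideal.Quotient.eq_zero_iff_mem.mpr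
        (h d hd p (Ideal.Quotient.eq_zero_iff_mem.mp hx') hp))
    · rintro ⟨_, p, hp, rfl⟩
      exact ⟨⟨_, p, hp, rfl⟩, rfl⟩
  exact (LinearEquiv.ofBijective L hL).finrank_eq.symm

/-! ### Growth of Hilbert functions -/

theorem finrank_map_mulLeft {k : Type u} [Field k]
    (I : HomogeneousIdeal (homogeneousSubmodule σ k)) (hI : I.toIdeal.IsPrime)
    {a : MvPolynomial σ k ⧸ I.toIdeal} (ha : a ≠ 0) (d : ℕ) :
    Module.finrank k ((quotientGrading (homogeneousSubmodule σ k) I d).map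
      (LinearMap.mulLeft k a)) = hilbertFunction I d := by
  have : IsDomain (MvPolynomial σ k ⧸ I.toIdeal) := Ideal.Quotient.isDomain _
  exact (Submodule.equivMapOfInjective (LinearMap.mulLeft k a) (mul_right_injective₀ ha)
    (quotientGrading (homogeneousSubmodule σ k) I d)).finrank_eq.symm

theorem map_mulLeft_le {k : Type u} [Field k] (I : HomogeneousIdeal (homogeneousSubmodule σ k))
    {a : MvPolynomial σ k ⧸ I.toIdeal} {e : ℕ}
    (ha : a ∈ quotientGrading (homogeneousSubmodule σ k) I e) (d : ℕ) :
    (quotientGrading (homogeneousSubmodule σ k) I d).map (LinearMap.mulLeft k a) ≤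
      quotientGrading (homogeneousSubmodule σ k) I (e + d) := by
  rintro _ ⟨b, hb, rfl⟩
  exact SetLike.mul_mem_graded ha hb

/-- Multiplication by a variable outside the prime ideal is injective and raises the degree by one.
-/
theorem hilbertFunction_mono {k : Type u} [Field k] [Finite σ]
    (I : HomogeneousIdeal (homogeneousSubmodule σ k)) (hI : I.toIdeal.IsPrime)
    {i : σ} (hi : MvPolynomial.X i ∉ I) : Monotone (hilbertFunction I) := by
  refine monotone_nat_of_le_succ fun d => ?_
  have ha : Ideal.Quotient.mk I.toIdeal (MvPolynomial.X i) ≠ 0 := fun h =>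
    hi (Ideal.Quotient.eq_zero_iff_mem.mp h)
  rw [← finrank_map_mulLeft I hI ha, add_comm]
  exact Submodule.finrank_mono (map_mulLeft_le I
    (ProjSubscheme.mk_mem_quotientGrading I (MvPolynomial.isHomogeneous_X k i)) d)

theorem hilbertFunction_pos {k : Type u} [Field k] [Finite σ]
    (I : HomogeneousIdeal (homogeneousSubmodule σ k)) (hI : I.toIdeal.IsPrime)
    {i : σ} (hi : MvPolynomial.X i ∉ I) (d : ℕ) : 0 < hilbertFunction I d := by
  have ha : Ideal.Quotient.mk I.toIdeal (MvPolynomial.X i ^ d) ≠ 0 := fun h =>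
    hi (hI.mem_of_pow_mem _ (Ideal.Quotient.eq_zero_iff_mem.mp h))
  exact Module.finrank_pos_iff_exists_ne_zero.mpr
    ⟨⟨_, ProjSubscheme.mk_mem_quotientGrading I (MvPolynomial.isHomogeneous_X_pow i d)⟩,
      fun h => ha (congrArg Subtype.val h)⟩

/-- A projective variety whose Hilbert function is bounded is a point. -/
theorem subsingleton_toScheme_of_hilbertFunction_eq {k : Type u} [Field k] [Finite σ]
    (Z : ProjSubscheme σ k) (hZ : Z.ideal.toIdeal.IsPrime) {d₀ : ℕ}
    (h : ∀ d ≥ d₀, hilbertFunction Z.ideal d = hilbertFunction Z.ideal d₀) :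
    Subsingleton Z.toScheme := by
  classical
  -- If `P` contains a nonzero form `b` of degree `e`, multiplication by `b` from degree `d₀` to
  -- degree `e + d₀` is injective between spaces of equal dimension, hence onto. So `P` contains all
  -- forms of degree `e + d₀`, and therefore all coordinates, which is impossible.
  have key (P : ProjectiveSpectrum (quotientGrading (homogeneousSubmodule σ k) Z.ideal)) :
      P.asHomogeneousIdeal = ⊥ := by
    rw [eq_bot_iff]
    intro a ha
    by_contra ha0
    have ha0' : a ≠ 0 := fun h0 => ha0 (h0 ▸ zero_mem _)
    obtain ⟨e, he⟩ : ∃ e, (DirectSum.decompose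
        (quotientGrading (homogeneousSubmodule σ k) Z.ideal) a e) ≠ 0 := by
      by_contra! h0
      refine ha0' ?_
      rw [← DirectSum.sum_support_decompose (quotientGrading (homogeneousSubmodule σ k) Z.ideal) a]
      exact Finset.sum_eq_zero fun e _ => congrArg Subtype.val (h0 e)
    set b := DirectSum.decompose (quotientGrading (homogeneousSubmodule σ k) Z.ideal) a e
    have hbP : (b : MvPolynomial σ k ⧸ Z.ideal.toIdeal) ∈ P.asHomogeneousIdeal.toIdeal :=
      P.asHomogeneousIdeal.isHomogeneous e ha
    have hb0 : (b : MvPolynomial σ k ⧸ Z.ideal.toIdeal) ≠ 0 := fun h0 => he (Subtype.ext h0)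
    have heq : (quotientGrading (homogeneousSubmodule σ k) Z.ideal d₀).map
        (LinearMap.mulLeft k (b : MvPolynomial σ k ⧸ Z.ideal.toIdeal)) =
          quotientGrading (homogeneousSubmodule σ k) Z.ideal (e + d₀) :=
      Submodule.eq_of_le_of_finrank_eq (map_mulLeft_le _ b.2 d₀)
        ((finrank_map_mulLeft _ hZ hb0 d₀).trans (h _ (Nat.le_add_left _ _)).symm)
    refine P.not_irrelevant_le (Z.irrelevant_le_span.trans (Ideal.span_le.mpr ?_))
    rintro _ ⟨j, rfl⟩
    have hj : Z.coordinate j ^ (e + d₀) ∈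
        quotientGrading (homogeneousSubmodule σ k) Z.ideal (e + d₀) := by
      simpa using SetLike.pow_mem_graded (e + d₀) (Z.coordinate_mem j)
    rw [← heq] at hj
    obtain ⟨r, -, hr⟩ := hj
    refine P.isPrime.mem_of_pow_mem (e + d₀) ?_
    rw [← hr]
    exact Ideal.mul_mem_right _ _ hbP
  constructor
  intro P Q
  exact ProjectiveSpectrum.ext ((key P).trans (key Q).symm)

theorem topologicalKrullDim_le_zero_of_subsingleton (T : Type*) [TopologicalSpace T]
    [Subsingleton T] : topologicalKrullDim T ≤ 0 := by
  have : Subsingleton (TopologicalSpace.IrreducibleCloseds T) := by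
    refine ⟨fun a b => ?_⟩
    have h (c : TopologicalSpace.IrreducibleCloseds T) : (c : Set T) = Set.univ := by
      obtain ⟨x, hx⟩ := c.isIrreducible.1
      exact Set.eq_univ_of_forall fun y => Subsingleton.elim x y ▸ hx
    exact SetLike.coe_injective ((h a).trans (h b).symm)
  exact Order.krullDim_nonpos_of_subsingleton

/-- There is no monotone positive sequence of polynomial growth whose value at `m d` is at least the
sum of its values up to `d`. -/
theorem false_of_sum_le_of_le_pow (H : ℕ → ℕ) (hmono : Monotone H) (hpos : ∀ d, 0 < H d)
    {r : ℕ} (hpow : ∀ d, H d ≤ (d + 1) ^ r) {m d₀ : ℕ}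
    (h : ∀ d ≥ d₀, ∑ e ∈ Finset.Icc d₀ d, H e ≤ H (m * d)) : False := by
  -- Summing over `[a, 2a]` gives `(a + 1) * H a ≤ H (2 * m * a) ≤ H (M * a)`. The extra `2` ensures
  -- `M ≥ 2`, and `a ≥ a₀` makes the factor at least `M ^ (r + 1)`.
  let M := 2 * m + 2
  let a₀ := d₀ + M ^ (r + 1)
  have hM : 2 ≤ M := Nat.le_add_left _ _
  have step (a : ℕ) (ha : a₀ ≤ a) : M ^ (r + 1) * H a ≤ H (M * a) := by
    have hd : d₀ ≤ a := (Nat.le_add_right _ _).trans ha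
    calc M ^ (r + 1) * H a ≤ (a + 1) * H a :=
          Nat.mul_le_mul_right _ (((Nat.le_add_left _ _).trans ha).trans (Nat.le_succ a))
      _ = ∑ e ∈ Finset.Icc a (2 * a), H a := by
          rw [Finset.sum_const, Nat.card_Icc, smul_eq_mul]
          congr 1
          omega
      _ ≤ ∑ e ∈ Finset.Icc a (2 * a), H e :=
          Finset.sum_le_sum fun e he => hmono (Finset.mem_Icc.mp he).1
      _ ≤ ∑ e ∈ Finset.Icc d₀ (2 * a), H e :=
          Finset.sum_le_sum_of_subset (Finset.Icc_subset_Icc_left hd)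
      _ ≤ H (m * (2 * a)) := h _ (by omega)
      _ ≤ H (M * a) := hmono (by
          rw [← mul_assoc, mul_comm m 2]
          exact Nat.mul_le_mul_right _ (Nat.le_add_right _ _))
  have iter (j : ℕ) : M ^ ((r + 1) * j) ≤ H (M ^ j * a₀) := by
    induction j with
    | zero => simpa using Nat.succ_le_of_lt (hpos a₀)
    | succ j ih =>
      have ha : a₀ ≤ M ^ j * a₀ := Nat.le_mul_of_pos_left _ (by positivity)
      calc M ^ ((r + 1) * (j + 1)) = M ^ (r + 1) * M ^ ((r + 1) * j) := by ring
        _ ≤ M ^ (r + 1) * H (M ^ j * a₀) := Nat.mul_le_mul_left _ ih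
        _ ≤ H (M * (M ^ j * a₀)) := step _ ha
        _ = H (M ^ (j + 1) * a₀) := by rw [pow_succ', mul_assoc]
  -- Along `M ^ j * a₀` the iterated lower bound grows like the power `r + 1` and the upper bound
  -- like the power `r`; what remains is `M ^ j ≤ (a₀ + 1) ^ r`, and this choice of `j` contradicts
  -- it.
  let j := (a₀ + 1) ^ r
  have h1 : M ^ (r * j) * M ^ j ≤ M ^ (r * j) * (a₀ + 1) ^ r :=
    calc M ^ (r * j) * M ^ j = M ^ ((r + 1) * j) := by ring
      _ ≤ H (M ^ j * a₀) := iter j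
      _ ≤ (M ^ j * a₀ + 1) ^ r := hpow _
      _ ≤ (M ^ j * (a₀ + 1)) ^ r := by
          refine Nat.pow_le_pow_left ?_ r
          rw [mul_add_one]
          exact Nat.add_le_add_left (Nat.one_le_pow _ _ (by omega)) _
      _ = M ^ (r * j) * (a₀ + 1) ^ r := by rw [mul_pow, ← pow_mul, mul_comm j r]
  have h2 : M ^ j ≤ j := Nat.le_of_mul_le_mul_left h1 (by positivity)
  exact absurd (Nat.lt_pow_self (n := j) hM) h2.not_gt

end Hilbert

/-! ## The ideal of a degeneration by projection -/

namespace ProjSubscheme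

section Family

variable {ι κ σ : Type} {k D : Type u} [Field k] [CommRing D] [Algebra k D]

/-- The parametrization `(z, w, t) ↦ (z, t w, t)` of the degeneration by projection of the closed
subscheme defined by the kernel of `ρ`. -/
def degenerationHom (ρ : MvPolynomial (ι ⊕ κ) k →ₐ[k] D) :
    MvPolynomial (ι ⊕ κ) k[X] →+* D[X] :=
  MvPolynomial.eval₂Hom (Polynomial.mapRingHom (algebraMap k D))
    (Sum.elim (fun i => Polynomial.C (ρ (MvPolynomial.X (Sum.inl i))))
      (fun j => Polynomial.X * Polynomial.C (ρ (MvPolynomial.X (Sum.inr j)))))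

/-- The graded ring homomorphism `k[t][x] → k[t, t⁻¹][x]`. -/
def toLaurentHom (σ : Type) (k : Type u) [Field k] :
    GradedRingHom (homogeneousSubmodule σ k[X]) (homogeneousSubmodule σ k[T;T⁻¹]) :=
  { MvPolynomial.map Polynomial.toLaurent with
    map_mem := fun hx => MvPolynomial.IsHomogeneous.map hx _ }

theorem scaling_C (c : k) : scaling ι κ k (MvPolynomial.C c) =
    MvPolynomial.C (LaurentPolynomial.C c) :=
  MvPolynomial.eval₂_C _ _ _

theorem scaling_X_inl (i : ι) : scaling ι κ k (MvPolynomial.X (Sum.inl i)) =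
    MvPolynomial.X (Sum.inl i) :=
  MvPolynomial.eval₂_X _ _ _

theorem scaling_X_inr (j : κ) : scaling ι κ k (MvPolynomial.X (Sum.inr j)) =
    MvPolynomial.C (LaurentPolynomial.T (-1)) * MvPolynomial.X (Sum.inr j) :=
  MvPolynomial.eval₂_X _ _ _

theorem degenerationHom_C (ρ : MvPolynomial (ι ⊕ κ) k →ₐ[k] D) (p : k[X]) :
    degenerationHom ρ (MvPolynomial.C p) = p.map (algebraMap k D) :=
  MvPolynomial.eval₂_C _ _ _

theorem degenerationHom_X_inl (ρ : MvPolynomial (ι ⊕ κ) k →ₐ[k] D) (i : ι) :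
    degenerationHom ρ (MvPolynomial.X (Sum.inl i)) =
      Polynomial.C (ρ (MvPolynomial.X (Sum.inl i))) :=
  MvPolynomial.eval₂_X _ _ _

theorem degenerationHom_X_inr (ρ : MvPolynomial (ι ⊕ κ) k →ₐ[k] D) (j : κ) :
    degenerationHom ρ (MvPolynomial.X (Sum.inr j)) =
      Polynomial.X * Polynomial.C (ρ (MvPolynomial.X (Sum.inr j))) :=
  MvPolynomial.eval₂_X _ _ _

/-- Substitution can be done with polynomial coefficients before `ρ` is applied; the vanishing of
the result is then a condition on each power of `t`. -/
theorem degenerationHom_eq_comp (ρ : MvPolynomial (ι ⊕ κ) k →ₐ[k] D) :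
    degenerationHom ρ = (Polynomial.mapRingHom (ρ : MvPolynomial (ι ⊕ κ) k →+* D)).comp
      (degenerationHom (AlgHom.id k (MvPolynomial (ι ⊕ κ) k))) := by
  refine MvPolynomial.ringHom_ext (fun p => ?_) ?_
  · rw [RingHom.comp_apply, degenerationHom_C, degenerationHom_C, Polynomial.coe_mapRingHom,
      Polynomial.map_map]
    congr 1
    exact (AlgHom.comp_algebraMap ρ).symm
  · rintro (i | j)
    · simp [degenerationHom_X_inl]
    · simp [degenerationHom_X_inr]

/-- For `t ≠ 0`, replacing `w` by `t⁻¹ w` recovers `F(z, w, t)` from `F(z, t w, t)`. -/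
theorem toLaurentHom_eq_comp : (toLaurentHom (ι ⊕ κ) k).toRingHom =
    (Polynomial.eval₂RingHom (scaling ι κ k).toRingHom
      (MvPolynomial.C (LaurentPolynomial.T 1))).comp
        (degenerationHom (AlgHom.id k (MvPolynomial (ι ⊕ κ) k))) := by
  refine MvPolynomial.ringHom_ext (fun p => ?_) ?_
  · rw [RingHom.comp_apply, degenerationHom_C]
    change MvPolynomial.map _ (MvPolynomial.C p) = _
    rw [MvPolynomial.map_C]
    induction p using Polynomial.induction_on' with
    | add p p' hp hp' => rw [map_add, map_add, hp, hp', Polynomial.map_add, map_add]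
    | monomial n a =>
      have := scaling_C (ι := ι) (κ := κ) a
      simp only [Polynomial.map_monomial, Polynomial.coe_eval₂RingHom, Polynomial.eval₂_monomial]
      rw [show (scaling ι κ k).toRingHom (algebraMap k (MvPolynomial (ι ⊕ κ) k) a) = _ from this,
        ← map_pow, ← map_mul, LaurentPolynomial.T_pow, mul_one,
        ← Polynomial.C_mul_X_pow_eq_monomial, Polynomial.toLaurent_C_mul_X_pow]
  · rintro (i | j)
    · rw [RingHom.comp_apply, degenerationHom_X_inl]
      simp only [AlgHom.id_apply, Polynomial.coe_eval₂RingHom, Polynomial.eval₂_C]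
      exact (MvPolynomial.map_X _ _).trans (scaling_X_inl i).symm
    · rw [RingHom.comp_apply, degenerationHom_X_inr]
      simp only [AlgHom.id_apply, Polynomial.coe_eval₂RingHom, Polynomial.eval₂_mul,
        Polynomial.eval₂_X, Polynomial.eval₂_C]
      rw [show (scaling ι κ k).toRingHom (MvPolynomial.X (Sum.inr j)) = _ from scaling_X_inr j,
        ← mul_assoc, ← map_mul, ← LaurentPolynomial.T_add]
      refine (MvPolynomial.map_X _ _).trans ?_
      simp

/-- The extension of `degenerationHom` to `t ≠ 0`. -/
def degenerationHomLaurent (ρ : MvPolynomial (ι ⊕ κ) k →ₐ[k] D) :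
    MvPolynomial (ι ⊕ κ) k[T;T⁻¹] →+* D[T;T⁻¹] :=
  MvPolynomial.eval₂Hom
    (LaurentPolynomial.eval₂ (LaurentPolynomial.C.comp (algebraMap k D))
      ⟨LaurentPolynomial.T 1, LaurentPolynomial.T (-1),
        by rw [← LaurentPolynomial.T_add]; simp, by rw [← LaurentPolynomial.T_add]; simp⟩)
    (Sum.elim (fun i => LaurentPolynomial.C (ρ (MvPolynomial.X (Sum.inl i))))
      (fun j => LaurentPolynomial.T 1 * LaurentPolynomial.C (ρ (MvPolynomial.X (Sum.inr j)))))

/-- The two rescalings of `w` cancel, which shows that the parametrization kills the ideal of the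
orbit of `Z`. -/
theorem degenerationHomLaurent_comp_scaling (ρ : MvPolynomial (ι ⊕ κ) k →ₐ[k] D) :
    (degenerationHomLaurent ρ).comp (scaling ι κ k).toRingHom =
      LaurentPolynomial.C.comp (ρ : MvPolynomial (ι ⊕ κ) k →+* D) := by
  refine MvPolynomial.ringHom_ext (fun c => ?_) ?_
  · rw [RingHom.comp_apply, show (scaling ι κ k).toRingHom (MvPolynomial.C c) = _ from scaling_C c]
    have : ρ (MvPolynomial.C c) = algebraMap k D c := ρ.commutes c
    simp [degenerationHomLaurent, this]
  · rintro (i | j)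
    · rw [RingHom.comp_apply,
        show (scaling ι κ k).toRingHom (MvPolynomial.X (Sum.inl i)) = _ from scaling_X_inl i]
      simp [degenerationHomLaurent]
    · rw [RingHom.comp_apply,
        show (scaling ι κ k).toRingHom (MvPolynomial.X (Sum.inr j)) = _ from scaling_X_inr j]
      simp [degenerationHomLaurent, ← mul_assoc]

theorem degenerationHomLaurent_comp_toLaurentHom (ρ : MvPolynomial (ι ⊕ κ) k →ₐ[k] D) :
    (degenerationHomLaurent ρ).comp (toLaurentHom (ι ⊕ κ) k).toRingHom =
      Polynomial.toLaurent.comp (degenerationHom ρ) := by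
  refine MvPolynomial.ringHom_ext (fun p => ?_) ?_
  · have h : (toLaurentHom (ι ⊕ κ) k).toRingHom (MvPolynomial.C p) =
        MvPolynomial.C (Polynomial.toLaurent p) := MvPolynomial.map_C _ _
    rw [RingHom.comp_apply, RingHom.comp_apply, degenerationHom_C, h]
    simp only [degenerationHomLaurent, MvPolynomial.coe_eval₂Hom, MvPolynomial.eval₂_C]
    induction p using Polynomial.induction_on' with
    | add p p' hp hp' =>
      rw [map_add, map_add, hp, hp', Polynomial.map_add, map_add] <;> exact MvPolynomial.map_C _ _
    | monomial n a =>
      rw [Polynomial.map_monomial, ← Polynomial.C_mul_X_pow_eq_monomial,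
        ← Polynomial.C_mul_X_pow_eq_monomial, Polynomial.toLaurent_C_mul_X_pow,
        Polynomial.toLaurent_C_mul_X_pow]
      simp
  · intro j
    have h : (toLaurentHom (ι ⊕ κ) k).toRingHom (MvPolynomial.X j) =
        MvPolynomial.X j := MvPolynomial.map_X _ _
    rw [RingHom.comp_apply, RingHom.comp_apply, h]
    rcases j with i | j
    · simp [degenerationHomLaurent, degenerationHom_X_inl]
    · simp [degenerationHomLaurent, degenerationHom_X_inr]

/-- If `F(z, t w, t)` is killed by `ρ`, each of its `t`-coefficients lies in the ideal of `Z`, and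
substituting back writes `F` as a combination of scaled equations of `Z`. The converse uses the
extension of the parametrization to Laurent polynomials. -/
theorem toLaurentHom_mem_iff {ρ : MvPolynomial (ι ⊕ κ) k →ₐ[k] D} {Z : ProjSubscheme (ι ⊕ κ) k}
    (hZ : ∀ p, p ∈ Z.ideal ↔ ρ p = 0) (F : MvPolynomial (ι ⊕ κ) k[X]) :
    toLaurentHom (ι ⊕ κ) k F ∈ Z.ideal.map (scaling ι κ k) ↔ degenerationHom ρ F = 0 := by
  constructor
  · intro hF
    have hle : Ideal.map (scaling ι κ k) Z.ideal.toIdeal ≤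
        RingHom.ker (degenerationHomLaurent ρ) := by
      rw [Ideal.map_le_iff_le_comap]
      intro p hp
      have h := RingHom.congr_fun (degenerationHomLaurent_comp_scaling ρ) p
      refine h.trans ?_
      rw [RingHom.comp_apply]
      exact (congrArg _ ((hZ p).mp hp)).trans (map_zero _)
    refine Polynomial.toLaurent_injective ?_
    rw [map_zero]
    exact (RingHom.congr_fun (degenerationHomLaurent_comp_toLaurentHom ρ) F).symm.trans (hle hF)
  · intro hF
    let G := degenerationHom (AlgHom.id k (MvPolynomial (ι ⊕ κ) k)) F
    have hG (n : ℕ) : G.coeff n ∈ Z.ideal := by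
      rw [hZ]
      have h := congrArg (fun f => Polynomial.coeff f n)
        (RingHom.congr_fun (degenerationHom_eq_comp ρ) F)
      simp only [hF, RingHom.comp_apply, Polynomial.coe_mapRingHom, Polynomial.coeff_map,
        Polynomial.coeff_zero] at h
      exact h.symm
    have h : toLaurentHom (ι ⊕ κ) k F = Polynomial.eval₂ (scaling ι κ k).toRingHom
        (MvPolynomial.C (LaurentPolynomial.T 1)) G :=
      RingHom.congr_fun toLaurentHom_eq_comp F
    rw [h, Polynomial.eval₂_eq_sum_range]
    exact sum_mem fun n _ => Ideal.mul_mem_right _ _ (Ideal.mem_map_of_mem _ (hG n))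

/-- The ideal is the kernel of a map to the domain `D[X]`, hence prime, and it omits a coordinate
`z`, so it equals its saturation. All later statements about the family use this description only.
-/
theorem mem_degenerationByProjection_ideal_iff [IsDomain D] {ρ : MvPolynomial (ι ⊕ κ) k →ₐ[k] D}
    {Z : ProjSubscheme (ι ⊕ κ) k} (hZ : ∀ p, p ∈ Z.ideal ↔ ρ p = 0)
    (hι : ∃ i, ρ (MvPolynomial.X (Sum.inl i)) ≠ 0) (F : MvPolynomial (ι ⊕ κ) k[X]) :
    F ∈ Z.degenerationByProjection.ideal ↔ degenerationHom ρ F = 0 := by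
  let I := (Z.ideal.map (scaling ι κ k)).comap (toLaurentHom (ι ⊕ κ) k)
  have hI (F : MvPolynomial (ι ⊕ κ) k[X]) : F ∈ I ↔ degenerationHom ρ F = 0 :=
    toLaurentHom_mem_iff hZ F
  have hker : I.toIdeal = RingHom.ker (degenerationHom ρ) := Ideal.ext hI
  have hprime : I.toIdeal.IsPrime := hker ▸ RingHom.ker_isPrime _
  have h : Z.degenerationByProjection.ideal = I := by
    obtain ⟨i, hi⟩ := hι
    refine zeroScheme_ideal_eq_of_isPrime hprime ⟨Sum.inl i, fun h => hi ?_⟩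
    have := (hI _).mp h
    rwa [degenerationHom_X_inl, Polynomial.C_eq_zero] at this
  rw [h, hI]

/-! ### Product families -/

/-- The parametrization of the product with the affine line of the closed subscheme defined by the
kernel of `ρ`. -/
def productHom (ρ : MvPolynomial σ k →ₐ[k] D) : MvPolynomial σ k[X] →+* D[X] :=
  MvPolynomial.eval₂Hom (Polynomial.mapRingHom (algebraMap k D))
    fun i => Polynomial.C (ρ (MvPolynomial.X i))

theorem productHom_C (ρ : MvPolynomial σ k →ₐ[k] D) (p : k[X]) :
    productHom ρ (MvPolynomial.C p) = p.map (algebraMap k D) :=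
  MvPolynomial.eval₂_C _ _ _

theorem productHom_map_C (ρ : MvPolynomial σ k →ₐ[k] D) (p : MvPolynomial σ k) :
    productHom ρ (MvPolynomial.map Polynomial.C p) = Polynomial.C (ρ p) := by
  have h : (productHom ρ).comp (MvPolynomial.map Polynomial.C) =
      Polynomial.C.comp (ρ : MvPolynomial σ k →+* D) := by
    refine MvPolynomial.ringHom_ext (fun c => ?_) fun i => ?_
    · have : ρ (MvPolynomial.C c) = algebraMap k D c := ρ.commutes c
      simp [productHom, this]
    · simp [productHom]
  exact RingHom.congr_fun h p

/-- The same argument as for the degeneration, without the twist: the ideal is tested on the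
coefficients of the powers of `t`. -/
theorem mem_prodAffineLine_ideal_iff [IsDomain D] {ρ : MvPolynomial σ k →ₐ[k] D}
    {Z : ProjSubscheme σ k} (hZ : ∀ p, p ∈ Z.ideal ↔ ρ p = 0)
    (hσ : ∃ i, ρ (MvPolynomial.X i) ≠ 0) (F : MvPolynomial σ k[X]) :
    F ∈ Z.prodAffineLine.ideal ↔ productHom ρ F = 0 := by
  let I := Z.ideal.map (scalarExtension σ (Polynomial.C : k →+* k[X]))
  have hcomp : productHom ρ = (Polynomial.mapRingHom (ρ : MvPolynomial σ k →+* D)).comp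
      (productHom (AlgHom.id k (MvPolynomial σ k))) := by
    refine MvPolynomial.ringHom_ext (fun p => ?_) fun i => ?_
    · simp only [productHom, RingHom.comp_apply, MvPolynomial.coe_eval₂Hom, MvPolynomial.eval₂_C,
        Polynomial.coe_mapRingHom, Polynomial.map_map]
      congr 1
      exact (AlgHom.comp_algebraMap ρ).symm
    · simp [productHom]
  -- Reordering `k[t][x]` as `k[x][t]` is undone, so `F` is recovered from its `t`-coefficients.
  have hback : (Polynomial.eval₂RingHom (MvPolynomial.map (σ := σ) (Polynomial.C : k →+* k[X]))
      (MvPolynomial.C Polynomial.X)).comp (productHom (AlgHom.id k (MvPolynomial σ k))) =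
        RingHom.id _ := by
    refine MvPolynomial.ringHom_ext (fun p => ?_) fun i => ?_
    · simp only [productHom, RingHom.comp_apply, MvPolynomial.coe_eval₂Hom, MvPolynomial.eval₂_C]
      induction p using Polynomial.induction_on' with
      | add p p' hp hp' => rw [map_add, map_add, hp, hp', map_add, map_add]
      | monomial n a =>
        simp [← Polynomial.C_mul_X_pow_eq_monomial]
    · simp [productHom]
  have hI (F : MvPolynomial σ k[X]) : F ∈ I ↔ productHom ρ F = 0 := by
    constructor
    · intro hF
      have hle : I.toIdeal ≤ RingHom.ker (productHom ρ) := by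
        refine Ideal.map_le_iff_le_comap.mpr fun p hp => ?_
        refine (productHom_map_C ρ p).trans ?_
        rw [(hZ p).mp hp, map_zero]
      exact hle hF
    · intro hF
      let G := productHom (AlgHom.id k (MvPolynomial σ k)) F
      have hG (n : ℕ) : G.coeff n ∈ Z.ideal := by
        rw [hZ]
        have h := congrArg (fun f => Polynomial.coeff f n) (RingHom.congr_fun hcomp F)
        simp only [hF, RingHom.comp_apply, Polynomial.coe_mapRingHom, Polynomial.coeff_map,
          Polynomial.coeff_zero] at h
        exact h.symm
      have h : F = Polynomial.eval₂ (MvPolynomial.map (σ := σ) (Polynomial.C : k →+* k[X]))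
          (MvPolynomial.C Polynomial.X) G := (RingHom.congr_fun hback F).symm
      rw [h, Polynomial.eval₂_eq_sum_range]
      exact sum_mem fun n _ => Ideal.mul_mem_right _ _ (Ideal.mem_map_of_mem _ (hG n))
  have hker : I.toIdeal = RingHom.ker (productHom ρ) := Ideal.ext hI
  have hprime : I.toIdeal.IsPrime := hker ▸ RingHom.ker_isPrime _
  have h : Z.prodAffineLine.ideal = I := by
    obtain ⟨i, hi⟩ := hσ
    refine zeroScheme_ideal_eq_of_isPrime hprime ⟨i, fun h => hi ?_⟩
    have := (hI _).mp h
    simpa [productHom] using this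
  rw [h, hI]

/-! ### The fibres of a degeneration by projection -/

/-- The restriction of `ρ` to the coordinates `z`. -/
def restrictInl (ρ : MvPolynomial (ι ⊕ κ) k →ₐ[k] D) : MvPolynomial ι k →ₐ[k] D :=
  ρ.comp (MvPolynomial.rename Sum.inl)

theorem restrictInl_X (ρ : MvPolynomial (ι ⊕ κ) k →ₐ[k] D) (i : ι) :
    restrictInl ρ (MvPolynomial.X i) = ρ (MvPolynomial.X (Sum.inl i)) := by
  simp [restrictInl]

/-- The restriction of polynomials to the subspace `w = 0`. -/
def restrictToSection (ι κ : Type) (k : Type u) [Field k] :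
    MvPolynomial (ι ⊕ κ) k →ₐ[k] MvPolynomial ι k :=
  MvPolynomial.aeval (Sum.elim MvPolynomial.X 0)

theorem restrictToSection_rename (p : MvPolynomial ι k) :
    restrictToSection ι κ k (MvPolynomial.rename Sum.inl p) = p := by
  have : (restrictToSection ι κ k).comp (MvPolynomial.rename Sum.inl) = AlgHom.id k _ := by
    ext i
    simp [restrictToSection]
  exact AlgHom.congr_fun this p

/-- Each `w` carries a factor `t`, so at `t = 0` only the restriction to `w = 0` survives. -/
theorem coeff_zero_degenerationHom (ρ : MvPolynomial (ι ⊕ κ) k →ₐ[k] D)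
    (F : MvPolynomial (ι ⊕ κ) k[X]) :
    (degenerationHom ρ F).eval 0 = restrictInl ρ (restrictToSection ι κ k
      (MvPolynomial.map (Polynomial.evalRingHom 0) F)) := by
  have h : (Polynomial.evalRingHom (0 : D)).comp (degenerationHom ρ) =
      (((restrictInl ρ).comp (restrictToSection ι κ k) : MvPolynomial (ι ⊕ κ) k →ₐ[k] D) :
        MvPolynomial (ι ⊕ κ) k →+* D).comp (MvPolynomial.map (Polynomial.evalRingHom 0)) := by
    refine MvPolynomial.ringHom_ext (fun p => ?_) ?_
    · rw [RingHom.comp_apply, RingHom.comp_apply, degenerationHom_C, MvPolynomial.map_C]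
      have : ((restrictInl ρ).comp (restrictToSection ι κ k))
          (MvPolynomial.C (Polynomial.evalRingHom 0 p)) = algebraMap k D (p.eval 0) :=
        AlgHom.commutes _ _
      refine Eq.trans ?_ this.symm
      simp [Polynomial.eval_map, Polynomial.eval₂_at_zero, Polynomial.coeff_zero_eq_eval_zero]
    · rintro (i | j)
      · simp [degenerationHom_X_inl, restrictToSection, restrictInl_X]
      · simp [degenerationHom_X_inr, restrictToSection]
  exact RingHom.congr_fun h F

theorem eval_one_degenerationHom (ρ : MvPolynomial (ι ⊕ κ) k →ₐ[k] D)
    (F : MvPolynomial (ι ⊕ κ) k[X]) :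
    (degenerationHom ρ F).eval 1 = ρ (MvPolynomial.map (Polynomial.evalRingHom 1) F) := by
  have h : (Polynomial.evalRingHom (1 : D)).comp (degenerationHom ρ) =
      (ρ : MvPolynomial (ι ⊕ κ) k →+* D).comp (MvPolynomial.map (Polynomial.evalRingHom 1)) := by
    refine MvPolynomial.ringHom_ext (fun p => ?_) ?_
    · rw [RingHom.comp_apply, RingHom.comp_apply, degenerationHom_C, MvPolynomial.map_C]
      have : ρ (MvPolynomial.C (Polynomial.evalRingHom 1 p)) = algebraMap k D (p.eval 1) :=
        AlgHom.commutes _ _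
      refine Eq.trans ?_ this.symm
      simp [Polynomial.eval_map, Polynomial.eval₂_at_one]
    · rintro (i | j)
      · simp [degenerationHom_X_inl]
      · simp [degenerationHom_X_inr]
  exact RingHom.congr_fun h F

theorem fiber_ideal_eq (Z : ProjSubscheme σ k[X]) (a : k) : (Z.fiber a).ideal =
    (zeroScheme (Z.ideal.map (scalarExtension σ (Polynomial.evalRingHom a)))).ideal := rfl

theorem mem_map_evalRingHom_iff (I : HomogeneousIdeal (homogeneousSubmodule σ k[X])) (a : k)
    (p : MvPolynomial σ k) : p ∈ I.map (scalarExtension σ (Polynomial.evalRingHom a)) ↔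
      ∃ F ∈ I, MvPolynomial.map (Polynomial.evalRingHom a) F = p :=
  mem_ideal_map_iff_of_surjective _ (fun c => ⟨Polynomial.C c, by simp⟩) I p

theorem degenerationHom_map_C_rename (ρ : MvPolynomial (ι ⊕ κ) k →ₐ[k] D) (p : MvPolynomial ι k) :
    degenerationHom ρ (MvPolynomial.map Polynomial.C (MvPolynomial.rename Sum.inl p)) =
      Polynomial.C (restrictInl ρ p) := by
  have h : ((degenerationHom ρ).comp (MvPolynomial.map Polynomial.C)).comp
      (MvPolynomial.rename (R := k) (Sum.inl : ι → ι ⊕ κ) : _ →+* _) =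
        Polynomial.C.comp (restrictInl ρ : MvPolynomial ι k →+* D) := by
    refine MvPolynomial.ringHom_ext (fun c => ?_) fun i => ?_
    · have : restrictInl ρ (MvPolynomial.C c) = algebraMap k D c := AlgHom.commutes _ _
      simp [degenerationHom_C, this]
    · simp [degenerationHom_X_inl, restrictInl_X]
  exact RingHom.congr_fun h p

theorem map_evalRingHom_map_C (a : k) (p : MvPolynomial σ k) :
    MvPolynomial.map (Polynomial.evalRingHom a) (MvPolynomial.map Polynomial.C p) = p := by
  rw [MvPolynomial.map_map]
  have : (Polynomial.evalRingHom a).comp Polynomial.C = RingHom.id k := by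
    ext
    simp
  rw [this, MvPolynomial.map_id]

/-- Every polynomial `p` extends to a family with the value `t ^ N * p (z, t⁻¹ w)` at `t`. -/
theorem exists_map_eval_one_eq (ρ : MvPolynomial (ι ⊕ κ) k →ₐ[k] D) (p : MvPolynomial (ι ⊕ κ) k) :
    ∃ N₀ : ℕ, ∀ N ≥ N₀, ∃ F : MvPolynomial (ι ⊕ κ) k[X],
      MvPolynomial.map (Polynomial.evalRingHom 1) F = p ∧
        degenerationHom ρ F = Polynomial.X ^ N * Polynomial.C (ρ p) := by
  induction p using MvPolynomial.induction_on with
  | C c =>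
    have hc : ρ (MvPolynomial.C c) = algebraMap k D c := AlgHom.commutes _ _
    refine ⟨0, fun N _ => ⟨MvPolynomial.C (Polynomial.X ^ N * Polynomial.C c), by simp, ?_⟩⟩
    rw [degenerationHom_C, hc]
    simp
  | add p p' hp hp' =>
    obtain ⟨a, ha⟩ := hp
    obtain ⟨b, hb⟩ := hp'
    refine ⟨max a b, fun N hN => ?_⟩
    obtain ⟨F, hF, hFp⟩ := ha N (le_of_max_le_left hN)
    obtain ⟨F', hF', hFp'⟩ := hb N (le_of_max_le_right hN)
    exact ⟨F + F', by rw [map_add, hF, hF'], by rw [map_add, hFp, hFp', map_add, map_add, mul_add]⟩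
  | mul_X p i hp =>
    obtain ⟨a, ha⟩ := hp
    rcases i with i | j
    · refine ⟨a, fun N hN => ?_⟩
      obtain ⟨F, hF, hFp⟩ := ha N hN
      refine ⟨F * MvPolynomial.X (Sum.inl i), by rw [map_mul, hF, MvPolynomial.map_X], ?_⟩
      rw [map_mul, hFp, degenerationHom_X_inl, map_mul, map_mul, mul_assoc]
    -- Each factor `w` brings one factor `t` of its own, so the exponent must be at least the degree
    -- in `w`.
    · refine ⟨a + 1, fun N hN => ?_⟩
      obtain ⟨N, rfl⟩ : ∃ n, N = n + 1 := ⟨N - 1, by omega⟩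
      obtain ⟨F, hF, hFp⟩ := ha N (by omega)
      refine ⟨F * MvPolynomial.X (Sum.inr j), by rw [map_mul, hF, MvPolynomial.map_X], ?_⟩
      rw [map_mul, hFp, degenerationHom_X_inr, map_mul, map_mul]
      ring

section

variable [IsDomain D] {ρ : MvPolynomial (ι ⊕ κ) k →ₐ[k] D} {Z : ProjSubscheme (ι ⊕ κ) k}
  (hZ : ∀ p, p ∈ Z.ideal ↔ ρ p = 0) (hι : ∃ i, ρ (MvPolynomial.X (Sum.inl i)) ≠ 0)

include hZ hι

/-- This is evaluation at `t = 0`; the power of `z_i` that comes from saturation can be cancelled,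
because `D` is a domain and some `z_i` is nonzero in it. -/
theorem restrictInl_restrictToSection_eq_zero {p : MvPolynomial (ι ⊕ κ) k}
    (hp : p ∈ (Z.degenerationByProjection.fiber 0).ideal) :
    restrictInl ρ (restrictToSection ι κ k p) = 0 := by
  obtain ⟨i, hi⟩ := id hι
  obtain ⟨n, hn⟩ := hp (Sum.inl i)
  obtain ⟨F, hF, hFp⟩ := (mem_map_evalRingHom_iff _ _ _).mp hn
  rw [mem_degenerationByProjection_ideal_iff hZ hι] at hF
  have h := coeff_zero_degenerationHom ρ F
  rw [hF, hFp, map_mul, map_pow, map_mul, map_pow, Polynomial.eval_zero] at h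
  have hX : restrictToSection ι κ k (MvPolynomial.X (Sum.inl i)) = MvPolynomial.X i := by
    simp [restrictToSection]
  rw [hX, restrictInl_X] at h
  exact (mul_eq_zero.mp h.symm).resolve_left (pow_ne_zero n hi)

/-- An equation in `z` alone is not affected by the action, so it holds on the whole family. -/
theorem mem_fiber_zero_of_restrictInl_eq_zero {p : MvPolynomial ι k} (hp : restrictInl ρ p = 0) :
    MvPolynomial.rename Sum.inl p ∈ (Z.degenerationByProjection.fiber 0).ideal := by
  rw [fiber_ideal_eq]
  refine le_zeroScheme_ideal _ ((mem_map_evalRingHom_iff _ _ _).mpr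
    ⟨MvPolynomial.map Polynomial.C (MvPolynomial.rename Sum.inl p), ?_, ?_⟩)
  · rw [mem_degenerationByProjection_ideal_iff hZ hι, degenerationHom_map_C_rename, hp, map_zero]
  · exact map_evalRingHom_map_C 0 _

theorem linearSection_fiber_zero_eq {W : ProjSubscheme ι k}
    (hW : ∀ p, p ∈ W.ideal ↔ restrictInl ρ p = 0) :
    (Z.degenerationByProjection.fiber 0).linearSection = W := by
  refine ext_ideal (Eq.trans ?_ W.zeroScheme_ideal_self)
  refine congrArg (fun I => (zeroScheme I).ideal) (le_antisymm ?_ fun p hp => ?_)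
  · exact Ideal.map_le_iff_le_comap.mpr fun p hp =>
      (hW _).mpr (restrictInl_restrictToSection_eq_zero hZ hι hp)
  · have h := mem_fiber_zero_of_restrictInl_eq_zero hZ hι ((hW p).mp hp)
    rw [← restrictToSection_rename (κ := κ) p]
    exact Ideal.mem_map_of_mem _ h

/-- If the coordinate `w` is not in the ideal of the special fibre, then the powers of its image are
linearly independent over the image of `k[z]`. -/
theorem restrictInl_eq_zero_of_sum_eq_zero
    (hQ : (Z.degenerationByProjection.fiber 0).ideal.toIdeal.IsPrime) {j : κ}
    (hj : MvPolynomial.X (Sum.inr j) ∉ (Z.degenerationByProjection.fiber 0).ideal) (n : ℕ)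
    (p : ℕ → MvPolynomial ι k)
    (h : ∑ e ∈ Finset.range n, ρ (MvPolynomial.X (Sum.inr j)) ^ e * restrictInl ρ (p e) = 0) :
    ∀ e < n, restrictInl ρ (p e) = 0 := by
  induction n with
  | zero => exact fun e he => absurd he (Nat.not_lt_zero e)
  | succ n ih =>
    have hn : restrictInl ρ (p n) = 0 := by
      -- The powers of `t` make up for the missing powers of `w`: the parametrization turns `F` into
      -- `t ^ n` times the given relation, while at `t = 0` only the top term remains.
      let F : MvPolynomial (ι ⊕ κ) k[X] := ∑ e ∈ Finset.range (n + 1),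
        MvPolynomial.C (Polynomial.X ^ (n - e)) * MvPolynomial.X (Sum.inr j) ^ e *
          MvPolynomial.map Polynomial.C (MvPolynomial.rename Sum.inl (p e))
      have hF : degenerationHom ρ F = 0 := by
        have : degenerationHom ρ F = Polynomial.X ^ n * Polynomial.C (∑ e ∈ Finset.range (n + 1),
            ρ (MvPolynomial.X (Sum.inr j)) ^ e * restrictInl ρ (p e)) := by
          rw [map_sum, map_sum, Finset.mul_sum]
          refine Finset.sum_congr rfl fun e he => ?_
          have he' : n = (n - e) + e := by
            have := Finset.mem_range.mp he
            omega
          rw [map_mul, map_mul, degenerationHom_C, map_pow, degenerationHom_X_inr,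
            degenerationHom_map_C_rename, Polynomial.map_pow, Polynomial.map_X, map_mul, map_pow]
          conv_rhs => rw [he', pow_add]
          ring
        rw [this, h, map_zero, mul_zero]
      have hF0 : MvPolynomial.map (Polynomial.evalRingHom 0) F =
          MvPolynomial.X (Sum.inr j) ^ n * MvPolynomial.rename Sum.inl (p n) := by
        rw [map_sum, Finset.sum_range_succ, Finset.sum_eq_zero, zero_add]
        · rw [map_mul, map_mul, map_evalRingHom_map_C, MvPolynomial.map_C, Nat.sub_self]
          simp
        · intro e he
          have he' : n - e ≠ 0 := by
            have := Finset.mem_range.mp he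
            omega
          rw [map_mul, map_mul, MvPolynomial.map_C]
          simp [he']
      have hmem : MvPolynomial.X (Sum.inr j) ^ n * MvPolynomial.rename Sum.inl (p n) ∈
          (Z.degenerationByProjection.fiber 0).ideal := by
        rw [fiber_ideal_eq]
        exact le_zeroScheme_ideal _ ((mem_map_evalRingHom_iff _ _ _).mpr
          ⟨F, (mem_degenerationByProjection_ideal_iff hZ hι F).mpr hF, hF0⟩)
      -- Primality removes the power of `w`, so the top coefficient vanishes and can be dropped from
      -- the relation.
      have h' := (hQ.mem_or_mem hmem).resolve_left fun h => hj (hQ.mem_of_pow_mem _ h)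
      have h'' := restrictInl_restrictToSection_eq_zero hZ hι h'
      rwa [restrictToSection_rename] at h''
    rw [Finset.sum_range_succ, hn, mul_zero, add_zero] at h
    intro e he
    rcases Nat.lt_succ_iff_lt_or_eq.mp he with he | rfl
    · exact ih h e he
    · exact hn

/-- The family has no torsion over `k[t]`, so its Hilbert functions at `t = 0` and `t = 1` agree. At
`t = 1` the ideal is that of `Z` itself; at `t = 0` it agrees with its saturation only in large
degrees. -/
theorem exists_hilbertFunction_fiber_zero_eq [Finite ι] [Finite κ] :
    ∃ d₀ : ℕ, ∀ d ≥ d₀, hilbertFunction (Z.degenerationByProjection.fiber 0).ideal d =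
      hilbertFunction Z.ideal d := by
  let I := Z.degenerationByProjection.ideal
  have hI (a : k[X]) (F : MvPolynomial (ι ⊕ κ) k[X]) (ha : a ≠ 0)
      (hF : MvPolynomial.C a * F ∈ I) : F ∈ I := by
    rw [mem_degenerationByProjection_ideal_iff hZ hι] at hF ⊢
    rw [map_mul, degenerationHom_C] at hF
    refine (mul_eq_zero.mp hF).resolve_left ?_
    exact (Polynomial.map_ne_zero_iff (algebraMap k D).injective).mpr ha
  have h1 : I.map (scalarExtension (ι ⊕ κ) (Polynomial.evalRingHom 1)) = Z.ideal := by
    refine HomogeneousIdeal.ext (Ideal.ext fun p => ?_)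
    refine (mem_map_evalRingHom_iff I 1 p).trans ⟨?_, fun hp => ?_⟩
    · rintro ⟨F, hF, rfl⟩
      rw [mem_degenerationByProjection_ideal_iff hZ hι] at hF
      exact (hZ _).mpr (by rw [← eval_one_degenerationHom, hF, Polynomial.eval_zero])
    · obtain ⟨N, hN⟩ := exists_map_eval_one_eq ρ p
      obtain ⟨F, hF, hFp⟩ := hN N le_rfl
      refine ⟨F, ?_, hF⟩
      rw [mem_degenerationByProjection_ideal_iff hZ hι, hFp, (hZ p).mp hp, map_zero, mul_zero]
  obtain ⟨d₀, hd₀⟩ := exists_hilbertFunction_zeroScheme_eq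
    (I.map (scalarExtension (ι ⊕ κ) (Polynomial.evalRingHom 0)))
  refine ⟨d₀, fun d hd => (hd₀ d hd).trans ?_⟩
  rw [hilbertFunction_map_evalRingHom I hI, ← hilbertFunction_map_evalRingHom I hI 1, h1]

end

end Family

end ProjSubscheme

namespace ProjSubscheme

/-! ## The special fibre of a degeneration by projection -/

section

variable {ι κ σ : Type} {k D : Type u} [Field k] [CommRing D] [Algebra k D]
  [IsDomain D] {ρ : MvPolynomial (ι ⊕ κ) k →ₐ[k] D} {Z : ProjSubscheme (ι ⊕ κ) k}
  (hZ : ∀ p, p ∈ Z.ideal ↔ ρ p = 0) (hι : ∃ i, ρ (MvPolynomial.X (Sum.inl i)) ≠ 0)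

include hZ hι

/-- Modulo the coordinates `w` every polynomial is congruent to its restriction to `w = 0`. -/
theorem mem_fiber_zero_iff
    (hκ : ∀ j, MvPolynomial.X (Sum.inr j) ∈ (Z.degenerationByProjection.fiber 0).ideal)
    (p : MvPolynomial (ι ⊕ κ) k) : p ∈ (Z.degenerationByProjection.fiber 0).ideal ↔
      restrictInl ρ (restrictToSection ι κ k p) = 0 := by
  refine ⟨restrictInl_restrictToSection_eq_zero hZ hι, fun h => ?_⟩
  let Q := (Z.degenerationByProjection.fiber 0).ideal.toIdeal
  have hQ : (Ideal.Quotient.mkₐ k Q).comp ((MvPolynomial.rename Sum.inl).comp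
      (restrictToSection ι κ k)) = Ideal.Quotient.mkₐ k Q := by
    refine MvPolynomial.algHom_ext fun i => ?_
    rcases i with i | j
    · simp [restrictToSection]
    · have : Ideal.Quotient.mk Q (MvPolynomial.X (Sum.inr j)) = 0 :=
        Ideal.Quotient.eq_zero_iff_mem.mpr (hκ j)
      simp [restrictToSection, this]
  have h' := mem_fiber_zero_of_restrictInl_eq_zero hZ hι h
  exact Ideal.Quotient.eq_zero_iff_mem.mp
    ((AlgHom.congr_fun hQ p).symm.trans (Ideal.Quotient.eq_zero_iff_mem.mpr h'))

/-- The special fibre is a variety if there are no coordinates `w`. -/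
theorem isVariety_fiber_zero_of_isEmpty [IsEmpty κ] :
    (Z.degenerationByProjection.fiber 0).IsVariety := by
  rw [isVariety_iff]
  have h := mem_fiber_zero_iff hZ hι isEmptyElim
  have hker : (Z.degenerationByProjection.fiber 0).ideal.toIdeal =
      RingHom.ker ((restrictInl ρ).comp (restrictToSection ι κ k)) := Ideal.ext h
  refine ⟨hker ▸ RingHom.ker_isPrime _, ?_⟩
  obtain ⟨i, hi⟩ := id hι
  refine ⟨Sum.inl i, fun hmem => hi ?_⟩
  have := (h _).mp hmem
  simpa [restrictToSection, restrictInl_X] using this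

variable {W : ProjSubscheme ι k} (hW : ∀ p, p ∈ W.ideal ↔ restrictInl ρ p = 0)

include hW

theorem hilbertFunction_fiber_zero_eq
    (hκ : ∀ j, MvPolynomial.X (Sum.inr j) ∈ (Z.degenerationByProjection.fiber 0).ideal) (d : ℕ) :
    hilbertFunction (Z.degenerationByProjection.fiber 0).ideal d = hilbertFunction W.ideal d := by
  have hmap : (homogeneousSubmodule (ι ⊕ κ) k d).map (restrictToSection ι κ k).toLinearMap =
      homogeneousSubmodule ι k d := by
    refine le_antisymm ?_ fun p hp => ?_
    · rintro _ ⟨p, hp, rfl⟩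
      have h := MvPolynomial.IsHomogeneous.aeval (n := 1) hp
        (Sum.elim MvPolynomial.X 0 : ι ⊕ κ → MvPolynomial ι k) (by
          rintro (i | j)
          · exact MvPolynomial.isHomogeneous_X _ _
          · exact MvPolynomial.isHomogeneous_zero _ _ _)
      rwa [one_mul] at h
    · exact ⟨_, MvPolynomial.IsHomogeneous.rename_isHomogeneous hp, restrictToSection_rename p⟩
  rw [hilbertFunction_eq_finrank_map W.ideal (restrictInl ρ).toLinearMap (fun p => (hW p).symm),
    hilbertFunction_eq_finrank_map _
      ((restrictInl ρ).toLinearMap ∘ₗ (restrictToSection ι κ k).toLinearMap)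
      (fun p => (mem_fiber_zero_iff hZ hι hκ p).symm), Submodule.map_comp, hmap]

/-- If a coordinate `w` does not vanish on the special fibre and that is a variety, then the
multiples of the powers of `w` contribute independently to the Hilbert function. -/
theorem sum_hilbertFunction_le [Finite ι] [Finite κ]
    (hQ : (Z.degenerationByProjection.fiber 0).ideal.toIdeal.IsPrime) {j : κ}
    (hj : MvPolynomial.X (Sum.inr j) ∉ (Z.degenerationByProjection.fiber 0).ideal) (d : ℕ) :
    ∑ e ∈ Finset.range (d + 1), hilbertFunction W.ideal e ≤ hilbertFunction Z.ideal d := by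
  have hW' := hilbertFunction_eq_finrank_map W.ideal (restrictInl ρ).toLinearMap
    (fun p => (hW p).symm)
  rw [hilbertFunction_eq_finrank_map Z.ideal ρ.toLinearMap (fun p => (hZ p).symm)]
  let V (e : ℕ) := (homogeneousSubmodule ι k e).map (restrictInl ρ).toLinearMap
  let U := (homogeneousSubmodule (ι ⊕ κ) k d).map ρ.toLinearMap
  have hV (e : ℕ) : Module.Finite k (V e) :=
    Module.Finite.iff_fg.mpr ((MvPolynomial.homogeneousSubmodule_fg ι k e).map _)
  have hU : Module.Finite k U :=
    Module.Finite.iff_fg.mpr ((MvPolynomial.homogeneousSubmodule_fg (ι ⊕ κ) k d).map _)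
  let g := ρ (MvPolynomial.X (Sum.inr j))
  -- Pairing `w ^ e` with forms of degree `d - e` in `z` lands in degree `d`; independence of the
  -- powers of `w` makes the sum direct.
  let L : (∀ e : Fin (d + 1), V (d - e)) →ₗ[k] D :=
    ∑ e : Fin (d + 1), LinearMap.mulLeft k (g ^ (e : ℕ)) ∘ₗ (V (d - e)).subtype ∘ₗ
      LinearMap.proj e
  have hL (v : ∀ e : Fin (d + 1), V (d - e)) : L v = ∑ e : Fin (d + 1), g ^ (e : ℕ) * (v e : D) := by
    simp [L]
  have hLU (v : ∀ e : Fin (d + 1), V (d - e)) : L v ∈ U := by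
    rw [hL]
    refine Submodule.sum_mem _ fun e _ => ?_
    obtain ⟨p, hp, hpv⟩ := (v e).2
    refine ⟨MvPolynomial.X (Sum.inr j) ^ (e : ℕ) * MvPolynomial.rename Sum.inl p, ?_, ?_⟩
    · have := (MvPolynomial.isHomogeneous_X_pow (R := k) (Sum.inr j : ι ⊕ κ) (e : ℕ)).mul
        (MvPolynomial.IsHomogeneous.rename_isHomogeneous (f := (Sum.inl : ι → ι ⊕ κ)) hp)
      rwa [Nat.add_sub_cancel' (Nat.le_of_lt_succ e.2)] at this
    · rw [← hpv]
      simp [g, restrictInl]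
  have hinj : Function.Injective (L.codRestrict U hLU) := by
    rw [injective_iff_map_eq_zero]
    intro v hv
    have hv' : L v = 0 := congrArg Subtype.val hv
    rw [hL] at hv'
    choose p _ hpv using fun e => (v e).2
    have key := restrictInl_eq_zero_of_sum_eq_zero hZ hι hQ hj (d + 1)
      (fun e => if h : e < d + 1 then p ⟨e, h⟩ else 0) (by
        rw [Finset.sum_range, ← hv']
        refine Finset.sum_congr rfl fun e _ => ?_
        rw [dif_pos e.2]
        exact congrArg _ (hpv e))
    ext e
    have := key e e.2
    rw [dif_pos e.2] at this
    exact (hpv e).symm.trans this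
  calc ∑ e ∈ Finset.range (d + 1), hilbertFunction W.ideal e
      = ∑ e ∈ Finset.range (d + 1), hilbertFunction W.ideal (d - e) := by
        rw [← Finset.sum_range_reflect]
        rfl
    _ = Module.finrank k (∀ e : Fin (d + 1), V (d - e)) := by
        rw [Module.finrank_pi_fintype, Finset.sum_range]
        exact Finset.sum_congr rfl fun e _ => hW' _
    _ ≤ Module.finrank k U := LinearMap.finrank_le_finrank_of_injective hinj

end

/-- Flatness excludes torsion, which makes the Hilbert function of the unsaturated fibres constant;
saturating them costs finitely many degrees. -/
theorem exists_hilbertFunction_fiber_eq {σ : Type} [Finite σ] {k : Type u} [Field k]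
    (𝔛 : ProjSubscheme σ k[X]) (h : Flat 𝔛.toBase) (a b : k) :
    ∃ d₀ : ℕ, ∀ d ≥ d₀,
      hilbertFunction (𝔛.fiber a).ideal d = hilbertFunction (𝔛.fiber b).ideal d := by
  have htf (r : k[X]) (p : MvPolynomial σ k[X]) (hr : r ≠ 0)
      (hp : MvPolynomial.C r * p ∈ 𝔛.ideal) : p ∈ 𝔛.ideal :=
    mem_ideal_of_C_mul_mem_of_flat 𝔛 h (mem_nonZeroDivisors_of_ne_zero hr) hp
  have key (a : k) : ∃ d₀ : ℕ, ∀ d ≥ d₀,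
      hilbertFunction (𝔛.fiber a).ideal d = hilbertFunction 𝔛.ideal d := by
    obtain ⟨d₀, hd₀⟩ := exists_hilbertFunction_zeroScheme_eq
      (𝔛.ideal.map (scalarExtension σ (Polynomial.evalRingHom a)))
    exact ⟨d₀, fun d hd => (hd₀ d hd).trans (hilbertFunction_map_evalRingHom _ htf a d)⟩
  obtain ⟨d₁, h₁⟩ := key a
  obtain ⟨d₂, h₂⟩ := key b
  exact ⟨max d₁ d₂, fun d hd =>
    (h₁ d (le_of_max_le_left hd)).trans (h₂ d (le_of_max_le_right hd)).symm⟩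

/-- The special fibre of a degeneration by projection of `Z` is not a variety if `Z` is a re-embedding
of a variety `X` by forms of degree at least `2` and the projection of `Z` has the same Hilbert
function as `X` in large degrees. -/
theorem not_isVariety_fiber_zero {ι κ σ : Type} [Finite ι] [Finite κ] [Finite σ]
    {k D : Type u} [Field k] [CommRing D] [Algebra k D] [IsDomain D]
    {ρ : MvPolynomial (ι ⊕ κ) k →ₐ[k] D} {Z : ProjSubscheme (ι ⊕ κ) k}
    (hZ : ∀ p, p ∈ Z.ideal ↔ ρ p = 0) (hι : ∃ i, ρ (MvPolynomial.X (Sum.inl i)) ≠ 0)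
    {W : ProjSubscheme ι k} (hW : ∀ p, p ∈ W.ideal ↔ restrictInl ρ p = 0)
    {X : ProjSubscheme σ k} (hX : X.IsVariety) (hdim : 0 < topologicalKrullDim X.toScheme)
    {m : ℕ} (hm : 2 ≤ m) (hZX : ∀ d, hilbertFunction Z.ideal d = hilbertFunction X.ideal (m * d))
    {d₀ : ℕ} (hWX : ∀ d ≥ d₀, hilbertFunction W.ideal d = hilbertFunction X.ideal d) :
    ¬ (Z.degenerationByProjection.fiber 0).IsVariety := by
  have := Fintype.ofFinite σ
  intro hvar
  have hQ := ((isVariety_iff _).mp hvar).1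
  obtain ⟨hI, i, hi⟩ := (isVariety_iff X).mp hX
  have hmono := hilbertFunction_mono X.ideal hI hi
  by_cases hκ : ∀ j, MvPolynomial.X (Sum.inr j) ∈ (Z.degenerationByProjection.fiber 0).ideal
  · obtain ⟨d₁, hd₁⟩ := exists_hilbertFunction_fiber_zero_eq hZ hι
    -- The bounds `d₀` and `d₁` put `a` into the stable range. The summand `1` makes `a` positive,
    -- so `d ≤ m ^ d * a`, and monotonicity spreads the equality at the points `m ^ n * a` to all
    -- larger degrees.
    let a := d₀ + d₁ + 1
    have step (d : ℕ) (hd : a ≤ d) :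
        hilbertFunction X.ideal (m * d) = hilbertFunction X.ideal d := by
      rw [← hZX, ← hd₁ d (by omega), hilbertFunction_fiber_zero_eq hZ hι hW hκ, hWX d (by omega)]
    have hpow (n : ℕ) : hilbertFunction X.ideal (m ^ n * a) = hilbertFunction X.ideal a := by
      induction n with
      | zero => rw [pow_zero, one_mul]
      | succ n ih =>
        rw [pow_succ', mul_assoc, step, ih]
        exact Nat.le_mul_of_pos_left _ (pow_pos (by omega) n)
    have hconst (d : ℕ) (hd : d ≥ a) : hilbertFunction X.ideal d = hilbertFunction X.ideal a := by
      refine le_antisymm ?_ (hmono hd)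
      rw [← hpow d]
      refine hmono (((Nat.lt_pow_self (by omega : 1 < m)).le).trans
        (Nat.le_mul_of_pos_right _ (Nat.succ_pos _)))
    have := subsingleton_toScheme_of_hilbertFunction_eq X hI hconst
    exact absurd hdim (not_lt.mpr (topologicalKrullDim_le_zero_of_subsingleton X.toScheme))
  · push Not at hκ
    obtain ⟨j, hj⟩ := hκ
    -- A form `w` survives on the special fibre, so the Hilbert function at `m * d` dominates the
    -- sum of its values up to `d`, against polynomial growth.
    refine false_of_sum_le_of_le_pow (hilbertFunction X.ideal) hmono
      (hilbertFunction_pos X.ideal hI hi) (hilbertFunction_le_pow X.ideal) (m := m) (d₀ := d₀)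
      fun d _ => ?_
    rw [← hZX]
    refine le_trans ?_ (sum_hilbertFunction_le hZ hι hW hQ hj d)
    calc ∑ e ∈ Finset.Icc d₀ d, hilbertFunction X.ideal e
        = ∑ e ∈ Finset.Icc d₀ d, hilbertFunction W.ideal e :=
          Finset.sum_congr rfl fun e he => (hWX e (Finset.mem_Icc.mp he).1).symm
      _ ≤ _ := Finset.sum_le_sum_of_subset fun e he => by
          have := (Finset.mem_Icc.mp he).2
          exact Finset.mem_range.mpr (by omega)

end ProjSubscheme

/-! ## Veronese embeddings -/

section Veronese

variable {ι κ : Type} {k : Type u} [Field k] {q m : ℕ}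

theorem SplitCoordinates.map_coord {σ : Type} (ℓ : SplitCoordinates ι κ σ k) :
    (homogeneousSubmodule (ι ⊕ κ) k 1).map ℓ.coord.toLinearMap = homogeneousSubmodule σ k 1 := by
  rw [MvPolynomial.homogeneousSubmodule_one_eq_span_X, Submodule.map_span, ← Set.range_comp]
  have h := congrArg (Submodule.map (homogeneousSubmodule σ k 1).subtype) ℓ.span_eq
  rw [Submodule.map_span, ← Set.range_comp, Submodule.map_top, Submodule.range_subtype] at h
  rw [← h]
  congr 2
  ext j : 1
  simp [coord]

theorem map_veronese :
    (homogeneousSubmodule (Monomials q m) k 1).map (veronese k q m).toLinearMap =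
      homogeneousSubmodule (Fin (q + 1)) k m := by
  rw [MvPolynomial.homogeneousSubmodule_one_eq_span_X, Submodule.map_span, ← Set.range_comp]
  refine le_antisymm (Submodule.span_le.mpr ?_) fun p hp => ?_
  · rintro _ ⟨α, rfl⟩
    exact veronese_isFormsMap k q m α
  · rw [p.as_sum]
    refine Submodule.sum_mem _ fun e he => ?_
    have hdeg : e.degree = m := by
      have := hp (MvPolynomial.mem_support_iff.mp he)
      rw [← this, Finsupp.degree_eq_weight_one]
      rfl
    rw [← mul_one (p.coeff e), ← MvPolynomial.C_mul_monomial, ← MvPolynomial.smul_eq_C_mul]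
    refine Submodule.smul_mem _ _ (Submodule.subset_span ⟨⟨e, hdeg⟩, ?_⟩)
    simp [veronese]

/-- The comorphism of the Veronese embedding in the coordinates `ℓ`. -/
def veroneseCoord (ℓ : SplitCoordinates ι κ (Monomials q m) k) :
    MvPolynomial (ι ⊕ κ) k →ₐ[k] MvPolynomial (Fin (q + 1)) k :=
  (veronese k q m).comp ℓ.coord

theorem veroneseCoord_isFormsMap (ℓ : SplitCoordinates ι κ (Monomials q m) k) :
    IsFormsMap (veroneseCoord ℓ) m := by
  intro j
  have h := (veronese_isFormsMap k q m).isHomogeneous (ℓ.coord_isFormsMap j)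
  rwa [mul_one] at h

/-- Forms of degree `d` are the `d`-th power of the space of linear forms, so the case of linear
forms suffices; there the coordinates give all monomials of degree `m`. -/
theorem map_veroneseCoord (ℓ : SplitCoordinates ι κ (Monomials q m) k) (d : ℕ) :
    (homogeneousSubmodule (ι ⊕ κ) k d).map (veroneseCoord ℓ).toLinearMap =
      homogeneousSubmodule (Fin (q + 1)) k (m * d) := by
  have h : (homogeneousSubmodule (ι ⊕ κ) k 1).map (veroneseCoord ℓ).toLinearMap =
      homogeneousSubmodule (Fin (q + 1)) k m := by
    rw [← map_veronese, ← ℓ.map_coord, ← Submodule.map_comp]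
    rfl
  rw [← MvPolynomial.homogeneousSubmodule_one_pow k d, Submodule.map_pow, h,
    ← MvPolynomial.homogeneousSubmodule_one_pow k m, ← pow_mul,
    MvPolynomial.homogeneousSubmodule_one_pow]

theorem surjective_veroneseCoord (ℓ : SplitCoordinates ι κ (Monomials q 1) k) :
    Function.Surjective (veroneseCoord ℓ) := by
  rw [← AlgHom.range_eq_top, eq_top_iff, ← MvPolynomial.adjoin_range_X, Algebra.adjoin_le_iff]
  rintro _ ⟨i, rfl⟩
  have h : (MvPolynomial.X i : MvPolynomial (Fin (q + 1)) k) ∈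
      homogeneousSubmodule (Fin (q + 1)) k (1 * 1) := MvPolynomial.isHomogeneous_X k i
  rw [← map_veroneseCoord ℓ 1] at h
  obtain ⟨p, -, hp⟩ := h
  exact ⟨p, hp⟩

/-- For `m = 1` the space of linear forms has dimension at most `q + 1`, which the coordinates `z`
already exhaust. -/
theorem SplitCoordinates.isEmpty_of_monomials_one {c : ℕ}
    (ℓ : SplitCoordinates (Fin (q + 1)) (Fin c) (Monomials q 1) k) : IsEmpty (Fin c) := by
  have hspan : homogeneousSubmodule (Monomials q 1) k 1 ≤ Submodule.span k (Set.range
      fun i : Fin (q + 1) => (MvPolynomial.X ⟨Finsupp.single i 1, Finsupp.degree_single i 1⟩ :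
        MvPolynomial (Monomials q 1) k)) := by
    rw [MvPolynomial.homogeneousSubmodule_one_eq_span_X]
    refine Submodule.span_mono ?_
    rintro _ ⟨⟨α, hα⟩, rfl⟩
    obtain ⟨i, rfl⟩ := (Finsupp.sum_eq_one_iff α).mp hα
    exact ⟨i, rfl⟩
  have := FiniteDimensional.span_of_finite k (Set.finite_range
    fun i : Fin (q + 1) => (MvPolynomial.X ⟨Finsupp.single i 1, Finsupp.degree_single i 1⟩ :
        MvPolynomial (Monomials q 1) k))
  have h := (Submodule.finrank_mono hspan).trans (finrank_range_le_card _)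
  rw [Module.finrank_eq_card_basis ℓ, Fintype.card_sum, Fintype.card_fin, Fintype.card_fin] at h
  rw [← Fintype.card_eq_zero_iff, Fintype.card_fin]
  omega

/-! ### The Veronese image of a variety and its projection. -/

namespace ProjSubscheme

/-- The homogeneous coordinates of the Veronese embedding on `X`. -/
def veroneseQuotient (ℓ : SplitCoordinates ι κ (Monomials q m) k)
    (X : ProjSubscheme (Fin (q + 1)) k) :
    MvPolynomial (ι ⊕ κ) k →ₐ[k] MvPolynomial (Fin (q + 1)) k ⧸ X.ideal.toIdeal :=
  (Ideal.Quotient.mkₐ k X.ideal.toIdeal).comp (veroneseCoord ℓ)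

theorem restrictInl_veroneseQuotient (ℓ : SplitCoordinates ι κ (Monomials q m) k)
    (X : ProjSubscheme (Fin (q + 1)) k) : restrictInl (veroneseQuotient ℓ X) =
      (Ideal.Quotient.mkₐ k X.ideal.toIdeal).comp (veroneseProjection ℓ) := by
  refine MvPolynomial.algHom_ext fun i => ?_
  simp [restrictInl, veroneseQuotient, veroneseCoord, veroneseProjection, SplitCoordinates.coord,
    SplitCoordinates.projection]

theorem veroneseQuotient_X_inl_eq_zero_iff (ℓ : SplitCoordinates ι κ (Monomials q m) k)
    (X : ProjSubscheme (Fin (q + 1)) k) (i : ι) :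
    veroneseQuotient ℓ X (MvPolynomial.X (Sum.inl i)) = 0 ↔
      veroneseProjection ℓ (MvPolynomial.X i) ∈ X.ideal := by
  rw [← restrictInl_X, restrictInl_veroneseQuotient]
  exact Ideal.Quotient.eq_zero_iff_mem

/-- Preimages of a prime are prime, so neither of the two images requires saturation once a variable
outside the ideal is found: the `m`-th power of a coordinate of `X` for the first, a coordinate `z`
for the second. -/
theorem mem_veroneseImage_ideal_iff (hm : 0 < m) (ℓ : SplitCoordinates ι κ (Monomials q m) k)
    {X : ProjSubscheme (Fin (q + 1)) k} (hX : X.IsVariety)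
    (hι : ∃ i, veroneseQuotient ℓ X (MvPolynomial.X (Sum.inl i)) ≠ 0)
    (p : MvPolynomial (ι ⊕ κ) k) :
    p ∈ (X.veroneseImage hm ℓ).ideal ↔ veroneseQuotient ℓ X p = 0 := by
  obtain ⟨hI, i, hi⟩ := (isVariety_iff X).mp hX
  have h₁ : (X.image (veronese k q m) hm (veronese_isFormsMap k q m)).ideal =
      X.ideal.comapForms _ hm (veronese_isFormsMap k q m) := by
    refine zeroScheme_ideal_eq_of_isPrime (hI.comap _)
      ⟨⟨Finsupp.single i m, Finsupp.degree_single i m⟩, fun h => hi (hI.mem_of_pow_mem m ?_)⟩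
    have h' : veronese k q m (MvPolynomial.X _) ∈ X.ideal.toIdeal := h
    rwa [veronese, MvPolynomial.aeval_X, ← MvPolynomial.X_pow_eq_monomial] at h'
  have h₂ : (X.veroneseImage hm ℓ).ideal =
      (X.ideal.comapForms _ hm (veronese_isFormsMap k q m)).comapForms _ Nat.one_pos
        ℓ.coord_isFormsMap := by
    rw [← h₁]
    refine zeroScheme_ideal_eq_of_isPrime ?_ ?_
    · rw [h₁]
      exact (hI.comap _).comap _
    · rw [h₁]
      obtain ⟨j, hj⟩ := hι
      exact ⟨Sum.inl j, fun h => hj (Ideal.Quotient.eq_zero_iff_mem.mpr h)⟩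
  rw [h₂]
  exact (Ideal.Quotient.eq_zero_iff_mem (I := X.ideal.toIdeal) (a := veroneseCoord ℓ p)).symm

/-- Forms of degree `d` on the target pull back onto the forms of degree `m * d`. -/
theorem hilbertFunction_veroneseImage (hm : 0 < m) (ℓ : SplitCoordinates ι κ (Monomials q m) k)
    {X : ProjSubscheme (Fin (q + 1)) k} (hX : X.IsVariety)
    (hι : ∃ i, veroneseQuotient ℓ X (MvPolynomial.X (Sum.inl i)) ≠ 0) (d : ℕ) :
    hilbertFunction (X.veroneseImage hm ℓ).ideal d = hilbertFunction X.ideal (m * d) := by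
  rw [hilbertFunction_eq_finrank_map _ (veroneseQuotient ℓ X).toLinearMap
    fun p => (mem_veroneseImage_ideal_iff hm ℓ hX hι p).symm]
  have : (homogeneousSubmodule (ι ⊕ κ) k d).map (veroneseQuotient ℓ X).toLinearMap =
      quotientGrading (homogeneousSubmodule (Fin (q + 1)) k) X.ideal (m * d) := by
    rw [quotientGrading, ← map_veroneseCoord ℓ d, ← Submodule.map_comp]
    rfl
  rw [this]
  rfl

/-- The coordinates `z` do not all vanish on `X`, and `W` is the closed image of `X` under
the projection. -/
theorem ideal_eq_of_isDominant (hm : 0 < m) (ℓ : SplitCoordinates ι κ (Monomials q m) k)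
    {X : ProjSubscheme (Fin (q + 1)) k} {W : ProjSubscheme ι k} (hX : X.IsVariety)
    (hW : W.IsVariety) (hφ : IsDominantVeroneseProjection hm ℓ X W) :
    (∃ i, veroneseQuotient ℓ X (MvPolynomial.X (Sum.inl i)) ≠ 0) ∧
      ∀ p, p ∈ W.ideal ↔ restrictInl (veroneseQuotient ℓ X) p = 0 := by
  obtain ⟨hI, i, hi⟩ := (isVariety_iff X).mp hX
  obtain ⟨hJ, j, hj⟩ := (isVariety_iff W).mp hW
  -- Let `x` and `w` be the generic points of `X` and `W`. The claim is that the projection is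
  -- defined at `x` and sends it to `w`.
  let x : ProjectiveSpectrum (homogeneousSubmodule (Fin (q + 1)) k) :=
    ⟨X.ideal, hI, fun h => hi (h (HomogeneousIdeal.mem_irrelevant_of_mem _ Nat.one_pos
      (MvPolynomial.isHomogeneous_X k i)))⟩
  let w : ProjectiveSpectrum (homogeneousSubmodule ι k) :=
    ⟨W.ideal, hJ, fun h => hj (h (HomogeneousIdeal.mem_irrelevant_of_mem _ Nat.one_pos
      (MvPolynomial.isHomogeneous_X k j)))⟩
  let K := X.ideal.comapForms (veroneseProjection ℓ) hm (veroneseProjection_isFormsMap ℓ)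
  have hw : w ∈ closure (formsMap (veroneseProjection ℓ) hm (veroneseProjection_isFormsMap ℓ) ''
      {P | X.ideal ≤ P.1.asHomogeneousIdeal}) := by
    rw [hφ]
    exact le_refl W.ideal
  -- `W` is nonempty, hence so is the image that is dense in it; a form that is nonzero at some
  -- point of `X` is nonzero at its generic point.
  have hx : x ∈ formsDomain (veroneseProjection ℓ) := by
    obtain ⟨_, P, hP, -⟩ := closure_nonempty_iff.mp ⟨w, hw⟩
    obtain ⟨i, hi⟩ := P.2
    exact ⟨i, fun h => hi (hP h)⟩
  have hWK : W.ideal ≤ K := by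
    have h : formsMap (veroneseProjection ℓ) hm (veroneseProjection_isFormsMap ℓ) ⟨x, hx⟩ ∈
        closure (formsMap (veroneseProjection ℓ) hm (veroneseProjection_isFormsMap ℓ) ''
          {P | X.ideal ≤ P.1.asHomogeneousIdeal}) :=
      subset_closure ⟨⟨x, hx⟩, le_refl X.ideal, rfl⟩
    rw [hφ] at h
    exact h
  have hKW : K ≤ W.ideal := by
    have h : closure (formsMap (veroneseProjection ℓ) hm (veroneseProjection_isFormsMap ℓ) ''
        {P | X.ideal ≤ P.1.asHomogeneousIdeal}) ⊆
          ProjectiveSpectrum.zeroLocus (homogeneousSubmodule ι k) K := by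
      refine closure_minimal ?_ (ProjectiveSpectrum.isClosed_zeroLocus _ _)
      rintro _ ⟨P, hP, rfl⟩
      exact fun p hp => hP hp
    exact h hw
  constructor
  · obtain ⟨i, hi⟩ := hx
    exact ⟨i, fun h => hi ((veroneseQuotient_X_inl_eq_zero_iff ℓ X i).mp h)⟩
  · intro p
    rw [restrictInl_veroneseQuotient]
    exact (⟨fun h => hWK h, fun h => hKW h⟩ : p ∈ W.ideal ↔ p ∈ K).trans
      (Ideal.Quotient.eq_zero_iff_mem (I := X.ideal.toIdeal) (a := veroneseProjection ℓ p)).symm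

/-- Without coordinates `w`, the degeneration by projection is trivial. -/
theorem isoOverBase_degenerationByProjection_of_isEmpty [IsEmpty κ]
    (ℓ : SplitCoordinates ι κ (Monomials q 1) k) {X : ProjSubscheme (Fin (q + 1)) k}
    (hX : X.IsVariety) (hι : ∃ i, veroneseQuotient ℓ X (MvPolynomial.X (Sum.inl i)) ≠ 0) :
    X.prodAffineLine.IsoOverBase (X.veroneseImage Nat.one_pos ℓ).degenerationByProjection := by
  obtain ⟨hI, i, hi⟩ := (isVariety_iff X).mp hX
  have := Ideal.Quotient.isDomain X.ideal.toIdeal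
  let π := Ideal.Quotient.mkₐ k X.ideal.toIdeal
  let g : MvPolynomial (ι ⊕ κ) k[X] →ₐ[k[X]] MvPolynomial (Fin (q + 1)) k[X] :=
    MvPolynomial.aeval fun j =>
      MvPolynomial.map Polynomial.C (veroneseCoord ℓ (MvPolynomial.X j))
  have hg (p : MvPolynomial (ι ⊕ κ) k) : g (MvPolynomial.map Polynomial.C p) =
      MvPolynomial.map Polynomial.C (veroneseCoord ℓ p) := by
    have h : (g : _ →+* MvPolynomial (Fin (q + 1)) k[X]).comp (MvPolynomial.map Polynomial.C) =
        (MvPolynomial.map Polynomial.C).comp (veroneseCoord ℓ : MvPolynomial (ι ⊕ κ) k →+* _) := by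
      refine MvPolynomial.ringHom_ext (fun c => ?_) fun j => ?_
      · have : veroneseCoord ℓ (MvPolynomial.C c) = MvPolynomial.C c := AlgHom.commutes _ _
        simp only [RingHom.comp_apply, MvPolynomial.map_C, RingHom.coe_coe, this]
        exact AlgHom.commutes g _
      · simp [g]
    exact RingHom.congr_fun h p
  -- Without `w`, no coordinate is multiplied by `t`, and the parametrization is the change of
  -- coordinates `g` followed by that of the product family.
  have hcomp : degenerationHom (veroneseQuotient ℓ X) =
      (productHom π).comp (g : MvPolynomial (ι ⊕ κ) k[X] →+* _) := by
    refine MvPolynomial.ringHom_ext (fun p => ?_) fun j => ?_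
    · have : g (MvPolynomial.C p) = MvPolynomial.C p := AlgHom.commutes _ _
      rw [degenerationHom_C, RingHom.comp_apply, RingHom.coe_coe, this,
        productHom_C]
    · rcases j with i | j
      · rw [degenerationHom_X_inl, RingHom.comp_apply, RingHom.coe_coe, MvPolynomial.aeval_X,
          productHom_map_C]
        rfl
      · exact isEmptyElim j
  refine isoOverBase_of_surjective g (fun j => ?_) ?_ (Ideal.ext fun F => ?_)
  · rw [MvPolynomial.aeval_X]
    exact (veroneseCoord_isFormsMap ℓ j).map _
  · rw [← AlgHom.range_eq_top, eq_top_iff, ← MvPolynomial.adjoin_range_X, Algebra.adjoin_le_iff]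
    rintro _ ⟨i, rfl⟩
    obtain ⟨p, hp⟩ := surjective_veroneseCoord ℓ (MvPolynomial.X i)
    exact ⟨MvPolynomial.map Polynomial.C p, (hg p).trans (by rw [hp, MvPolynomial.map_X])⟩
  · refine (mem_degenerationByProjection_ideal_iff
      (mem_veroneseImage_ideal_iff Nat.one_pos ℓ hX hι) hι F).trans ?_
    rw [hcomp]
    exact (mem_prodAffineLine_ideal_iff (ρ := π) (Z := X)
      (fun p => Ideal.Quotient.eq_zero_iff_mem.symm)
      ⟨i, fun h => hi (Ideal.Quotient.eq_zero_iff_mem.mp h)⟩ (g F)).symm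

theorem IsoOverBase.symm {σ τ : Type} {A : Type u} [CommRing A] {Z : ProjSubscheme σ A}
    {Z' : ProjSubscheme τ A} (h : Z.IsoOverBase Z') : Z'.IsoOverBase Z := by
  obtain ⟨e, he⟩ := h
  exact ⟨e.symm, by rw [← he, Iso.symm_hom, Iso.inv_hom_id_assoc]⟩

theorem IsoOverBase.trans {σ τ υ : Type} {A : Type u} [CommRing A] {Z : ProjSubscheme σ A}
    {Z' : ProjSubscheme τ A} {Z'' : ProjSubscheme υ A} (h : Z.IsoOverBase Z')
    (h' : Z'.IsoOverBase Z'') : Z.IsoOverBase Z'' := by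
  obtain ⟨e, he⟩ := h
  obtain ⟨e', he'⟩ := h'
  exact ⟨e ≪≫ e', by rw [← he, ← he', Iso.trans_hom, Category.assoc]⟩

end ProjSubscheme

end Veronese

/-! ### The main theorem. -/

theorem mainTheorem3 {k : Type u} [Field k] {q : ℕ}
    (𝔛 : ProjSubscheme (Fin (q + 1)) k[X]) (X W : ProjSubscheme (Fin (q + 1)) k)
    (hX : X.IsVariety) (hdim : 0 < topologicalKrullDim X.toScheme)
    (h𝔛 : 𝔛.IsToricDegeneration X W)
    {m : ℕ} (hm : 0 < m) {c : ℕ} (ℓ : SplitCoordinates (Fin (q + 1)) (Fin c) (Monomials q m) k)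
    (hφ : IsDominantVeroneseProjection hm ℓ X W) :
    (((X.veroneseImage hm ℓ).degenerationByProjection.fiber 0).IsVariety ↔ m = 1) ∧
      (¬ 𝔛.IsTrivialDegeneration X →
        ¬ 𝔛.IsoOverBase (X.veroneseImage hm ℓ).degenerationByProjection) ∧
      ((X.veroneseImage hm ℓ).degenerationByProjection.fiber 0).linearSection = W := by
  have hWvar : W.IsVariety := h𝔛.toric.1
  have := ((ProjSubscheme.isVariety_iff X).mp hX).1
  have := Ideal.Quotient.isDomain X.ideal.toIdeal
  obtain ⟨hι, hW⟩ := ProjSubscheme.ideal_eq_of_isDominant hm ℓ hX hWvar hφ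
  have hZ := ProjSubscheme.mem_veroneseImage_ideal_iff hm ℓ hX hι
  have hiff : ((X.veroneseImage hm ℓ).degenerationByProjection.fiber 0).IsVariety ↔ m = 1 := by
    constructor
    · intro hvar
      by_contra hm1
      obtain ⟨d₀, hd₀⟩ := ProjSubscheme.exists_hilbertFunction_fiber_eq 𝔛 h𝔛.flat 0 1
      rw [h𝔛.fiber_one, h𝔛.fiber_zero] at hd₀
      exact ProjSubscheme.not_isVariety_fiber_zero hZ hι hW hX hdim (by omega : 2 ≤ m)
        (ProjSubscheme.hilbertFunction_veroneseImage hm ℓ hX hι) hd₀ hvar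
    · rintro rfl
      have := ℓ.isEmpty_of_monomials_one
      exact ProjSubscheme.isVariety_fiber_zero_of_isEmpty hZ hι
  refine ⟨hiff, fun htriv hiso => ?_, ProjSubscheme.linearSection_fiber_zero_eq hZ hι hW⟩
  -- An isomorphism of families identifies the fibres over `0`. So the special fibre of the
  -- projection family is a variety, which forces `m = 1`, and then that family is trivial.
  obtain ⟨e⟩ := ProjSubscheme.nonempty_iso_baseChange (Polynomial.evalRingHom (0 : k))
    (fun a => ⟨Polynomial.C a, by simp⟩) hiso
  have h0 : (𝔛.fiber 0).IsVariety := h𝔛.fiber_zero ▸ hWvar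
  obtain rfl := hiff.mp (ProjSubscheme.isVariety_of_iso h0 e)
  have := ℓ.isEmpty_of_monomials_one
  exact htriv (hiso.trans
    (ProjSubscheme.isoOverBase_degenerationByProjection_of_isEmpty ℓ hX hι).symm)

end
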